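/- Let $d \ge 2$. For integers $N \ge 2$ and $0 < k \le N^d$, the $k$-model of fractal percolation is defined as follows. Divide the unit cube $[0,1]^d$ into $N^d$ closed subcubes of side length $1/N$ and retain $k$ of them, uniformly among all sets of exactly $k$ subcubes; let $D_k^1$ be the union of the retained subcubes. Divide each retained subcube into $N^d$ subcubes of side length $1/N^2$ and, independently for each retained subcube, retain a uniformly chosen set of exactly $k$ of them; let $D_k^2$ be the union of all retained cubes of side length $1/N^2$. Iterate this at all smaller scales and set $D_k := \bigcap_{n \ge 1} D_k^n$. Let $\theta(k,N,d)$ be the probability that some connected component of $D_k$ intersects both $\{0\}\times[0,1]^{d-1}$ and $\{1\}\times[0,1]^{d-1}$, and let \[ k_c(N,d) := \min\{k : 0 < k \le N^d,\ \theta(k,N,d) > 0\}. \] Let $\mathbb{L}^d$ be the lattice with vertex set $\mathbb{Z}^d$ in which $x \sim y$ if and only if $x \ne y$, $|x_i-y_i| \le 1$ for all $i$, and $x_i = y_i$ for at least one $i$. Let $p_c(d)$ be the critical probability of site percolation on $\mathbb{L}^d$, that is, the infimum of those $p \in [0,1]$ for which the open cluster of the origin is infinite with positive probability when the vertices are open independently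 with probability $p$. Then \[ \liminf_{N\to\infty} \frac{k_c(N,d)}{N^d} \ \ge\ p_c(d). \] -/

import Mathlib

open MeasureTheory ProbabilityTheory Filter

noncomputable section

/-! ### The `k`-model of fractal percolation -/

/-- Labels of the `N ^ d` subcubes into which a cube is divided. -/
abbrev SubcubeIndex (N d : ℕ) : Type := Fin d → Fin N

/-- The lower corner of the level-`n` cube with address `I = [i₁, …, iₙ]` (coarsest label first):
its `j`-th coordinate is `i₁(j) / N + i₂(j) / N ^ 2 + ⋯ + iₙ(j) / N ^ n`. -/
def lowerCorner (N d : ℕ) (I : List (SubcubeIndex N d)) (j : Fin d) : ℝ :=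
  ∑ m : Fin I.length, ((I.get m j : ℕ) : ℝ) / (N : ℝ) ^ ((m : ℕ) + 1)

/-- The closed level-`n` cube with address `I`, of side length `N ^ (-n)`, where `n` is the length
of `I`. The empty address gives the unit cube. -/
def levelCube (N d : ℕ) (I : List (SubcubeIndex N d)) : Set (Fin d → ℝ) :=
  {x | ∀ j, lowerCorner N d I j ≤ x j ∧ x j ≤ lowerCorner N d I j + 1 / (N : ℝ) ^ I.length}

/-- A configuration: for every cube (given by its address), the set of (labels of) subcubes of it
that are selected. -/
abbrev Configuration (N d : ℕ) : Type := List (SubcubeIndex N d) → Finset (SubcubeIndex N d)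

/-- A cube is retained if it, and each of its ancestors below the unit cube, is selected as a
subcube of its parent. -/
def IsRetained {N d : ℕ} (ω : Configuration N d) (I : List (SubcubeIndex N d)) : Prop :=
  ∀ (J : List (SubcubeIndex N d)) (i : SubcubeIndex N d), J ++ [i] <+: I → i ∈ ω J

/-- The union of the (closed) retained level-`n` cubes; for `n = 0` it is the unit cube. -/
def levelSet {N d : ℕ} (ω : Configuration N d) (n : ℕ) : Set (Fin d → ℝ) :=
  ⋃ I ∈ {I : List (SubcubeIndex N d) | I.length = n ∧ IsRetained ω I}, levelCube N d I

/-- The limit set of the construction. -/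
def limitSet {N d : ℕ} (ω : Configuration N d) : Set (Fin d → ℝ) :=
  ⋂ n : ℕ, levelSet ω n

/-- The unit cube is crossed by `F ⊆ [0,1]^d`: some connected component of `F` meets both
`{0} × [0,1]^(d-1)` and `{1} × [0,1]^(d-1)`. -/
def IsCrossedBy {d : ℕ} [NeZero d] (F : Set (Fin d → ℝ)) : Prop :=
  ∃ x ∈ F, (connectedComponentIn F x ∩ {y | y ∈ Set.Icc 0 1 ∧ y 0 = 0}).Nonempty ∧
    (connectedComponentIn F x ∩ {y | y ∈ Set.Icc 0 1 ∧ y 0 = 1}).Nonempty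

/-- The law of the `k`-model, for `k ≤ N ^ d`: independently for all cubes, the set of selected
subcubes is uniformly distributed among the sets of exactly `k` subcubes. -/
def kModelMeasure (k N d : ℕ) : Measure (Configuration N d) :=
  Measure.infinitePi fun _ : List (SubcubeIndex N d) =>
    uniformOn {A : Finset (SubcubeIndex N d) | A.card = k}

/-- `θ(k, N, d)`: the probability that the unit cube is crossed by the limit set of the
`k`-model. -/
def kCrossingProb (k N d : ℕ) [NeZero d] : ENNReal :=
  kModelMeasure k N d {ω | IsCrossedBy (limitSet ω)}

/-- `k_c(N, d)`: the smallest `k` with `0 < k ≤ N ^ d` and `θ(k, N, d) > 0`. -/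
def kCritical (N d : ℕ) [NeZero d] : ℕ :=
  sInf {k : ℕ | 0 < k ∧ k ≤ N ^ d ∧ 0 < kCrossingProb k N d}

/-! ### Site percolation on the lattice `𝕃^d` -/

/-- The lattice with vertex set `ℤ^d` in which distinct `x`, `y` are adjacent if and only if
`|x_i - y_i| ≤ 1` for all `i` and `x_i = y_i` for at least one `i`. -/
def latticeL (d : ℕ) : SimpleGraph (Fin d → ℤ) where
  Adj x y := x ≠ y ∧ (∀ i, |x i - y i| ≤ 1) ∧ ∃ i, x i = y i
  symm := ⟨fun x y h => ⟨h.1.symm, fun i => by rw [abs_sub_comm]; exact h.2.1 i,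
    h.2.2.imp fun _ hi => hi.symm⟩⟩
  loopless := ⟨fun _ h => h.1 rfl⟩

/-- The open cluster of `x` when `S` is the set of open sites: all sites that are joined to `x` by
a path of open sites (it is empty if `x` is not open). -/
def openCluster {d : ℕ} (S : Set (Fin d → ℤ)) (x : Fin d → ℤ) : Set (Fin d → ℤ) :=
  {y | ∃ (hx : x ∈ S) (hy : y ∈ S), ((latticeL d).induce S).Reachable ⟨x, hx⟩ ⟨y, hy⟩}

/-- The probability that the open cluster of the origin is infinite, when every site is open with
probability `p`, independently of all other sites. -/
def sitePercolationProb (d : ℕ) (p : unitInterval) : ENNReal :=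
  setBernoulli (Set.univ : Set (Fin d → ℤ)) p {S | (openCluster S 0).Infinite}

/-- `p_c(d)`: the critical probability for site percolation on `𝕃^d`. -/
def siteCritical (d : ℕ) : ℝ :=
  sInf {p : ℝ | ∃ hp : p ∈ unitInterval, 0 < sitePercolationProb d ⟨p, hp⟩}

end

section BernoulliExpectation

variable {α β : Type*} [DecidableEq α] [DecidableEq β]

/-- The expectation of `f A`, where the random set `A` contains each element of the finite set `V`
with probability `p`, independently. -/
noncomputable def bernExp (V : Finset α) (p : ℝ) (f : Finset α → ℝ) : ℝ :=
  ∑ A ∈ V.powerset, p ^ A.card * (1 - p) ^ (V \ A).card * f A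

theorem bernExp_empty (p : ℝ) (f : Finset α → ℝ) : bernExp ∅ p f = f ∅ := by
  simp [bernExp]

theorem bernExp_insert {V : Finset α} {v : α} (hv : v ∉ V) (p : ℝ) (f : Finset α → ℝ) :
    bernExp (insert v V) p f =
      (1 - p) * bernExp V p f + p * bernExp V p (fun A => f (insert v A)) := by
  unfold bernExp
  rw [Finset.sum_powerset_insert hv, Finset.mul_sum, Finset.mul_sum]
  congr 1
  · refine Finset.sum_congr rfl fun A hA => ?_
    have hvA : v ∉ A := fun h => hv (Finset.mem_powerset.1 hA h)
    rw [Finset.insert_sdiff_of_notMem _ hvA, Finset.card_insert_of_notMem (by simp [hv]), pow_succ]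
    ring
  · refine Finset.sum_congr rfl fun A hA => ?_
    have hvA : v ∉ A := fun h => hv (Finset.mem_powerset.1 hA h)
    have : insert v V \ insert v A = V \ A := by
      ext x; simp only [Finset.mem_sdiff, Finset.mem_insert]; grind
    rw [this, Finset.card_insert_of_notMem hvA, pow_succ]
    ring

theorem bernExp_congr {V : Finset α} {p : ℝ} {f g : Finset α → ℝ} (h : ∀ A ⊆ V, f A = g A) :
    bernExp V p f = bernExp V p g :=
  Finset.sum_congr rfl fun A hA => by rw [h A (Finset.mem_powerset.1 hA)]

theorem bernExp_add (V : Finset α) (p : ℝ) (f g : Finset α → ℝ) :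
    bernExp V p (fun A => f A + g A) = bernExp V p f + bernExp V p g := by
  simp [bernExp, mul_add, Finset.sum_add_distrib]

theorem bernExp_const_mul (V : Finset α) (p c : ℝ) (f : Finset α → ℝ) :
    bernExp V p (fun A => c * f A) = c * bernExp V p f := by
  rw [bernExp, bernExp, Finset.mul_sum]
  exact Finset.sum_congr rfl fun A _ => by ring

theorem bernExp_mul_const (V : Finset α) (p c : ℝ) (f : Finset α → ℝ) :
    bernExp V p (fun A => f A * c) = bernExp V p f * c := by
  rw [mul_comm, ← bernExp_const_mul]
  simp only [mul_comm]

theorem bernExp_sub (V : Finset α) (p : ℝ) (f g : Finset α → ℝ) :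
    bernExp V p (fun A => f A - g A) = bernExp V p f - bernExp V p g := by
  simp [bernExp, mul_sub, Finset.sum_sub_distrib]

theorem bernExp_finset_sum {ι : Type*} (s : Finset ι) (V : Finset α) (p : ℝ)
    (f : ι → Finset α → ℝ) :
    bernExp V p (fun A => ∑ i ∈ s, f i A) = ∑ i ∈ s, bernExp V p (f i) := by
  simp only [bernExp, Finset.mul_sum]
  exact Finset.sum_comm

theorem bernExp_const (V : Finset α) (p c : ℝ) : bernExp V p (fun _ => c) = c := by
  induction V using Finset.induction_on with
  | empty => exact bernExp_empty _ _
  | insert v V hv ih => rw [bernExp_insert hv, ih]; ring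

theorem bernExp_mono {V : Finset α} {p : ℝ} (h0 : 0 ≤ p) (h1 : p ≤ 1) {f g : Finset α → ℝ}
    (h : ∀ A ⊆ V, f A ≤ g A) : bernExp V p f ≤ bernExp V p g :=
  Finset.sum_le_sum fun A hA =>
    mul_le_mul_of_nonneg_left (h A (Finset.mem_powerset.1 hA))
      (mul_nonneg (pow_nonneg h0 _) (pow_nonneg (by linarith) _))

theorem bernExp_nonneg {V : Finset α} {p : ℝ} (h0 : 0 ≤ p) (h1 : p ≤ 1) {f : Finset α → ℝ}
    (h : ∀ A ⊆ V, 0 ≤ f A) : 0 ≤ bernExp V p f := by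
  have := bernExp_mono h0 h1 (f := fun _ => 0) h
  rwa [bernExp_const] at this

theorem bernExp_union {V W : Finset α} (hVW : Disjoint V W) (p : ℝ) (f : Finset α → ℝ) :
    bernExp (V ∪ W) p f = bernExp V p (fun A => bernExp W p (fun B => f (A ∪ B))) := by
  induction W using Finset.induction_on generalizing f with
  | empty => simp [bernExp_empty]
  | insert w W hw ih =>
    rw [Finset.disjoint_insert_right] at hVW
    rw [Finset.union_insert, bernExp_insert (by simp [hw, hVW.1]), ih hVW.2, ih hVW.2]
    simp only [bernExp_insert hw, bernExp_add, bernExp_const_mul, Finset.union_insert]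

theorem bernExp_split {S V : Finset α} (hS : S ⊆ V) (p : ℝ) (g h : Finset α → ℝ) :
    bernExp V p (fun A => g (A ∩ S) * h (A \ S)) = bernExp S p g * bernExp (V \ S) p h := by
  conv_lhs => rw [← Finset.union_sdiff_of_subset hS]
  rw [bernExp_union Finset.disjoint_sdiff, ← bernExp_mul_const]
  refine bernExp_congr fun A hA => ?_
  rw [← bernExp_const_mul]
  refine bernExp_congr fun B hB => ?_
  have h1 : (A ∪ B) ∩ S = A := by
    ext x; have := @hA x; have := @hB x; simp only [Finset.mem_sdiff] at this; simp; tauto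
  have h2 : (A ∪ B) \ S = B := by
    ext x; have := @hA x; have := @hB x; simp only [Finset.mem_sdiff] at this; simp; tauto
  rw [h1, h2]

theorem bernExp_inter {S V : Finset α} (hS : S ⊆ V) (p : ℝ) (g : Finset α → ℝ) :
    bernExp V p (fun A => g (A ∩ S)) = bernExp S p g := by
  have := bernExp_split hS p g (fun _ => 1)
  simpa [bernExp_const] using this

theorem bernExp_sdiff {S V : Finset α} (hS : S ⊆ V) (p : ℝ) (h : Finset α → ℝ) :
    bernExp V p (fun A => h (A \ S)) = bernExp (V \ S) p h := by
  have := bernExp_split hS p (fun _ => 1) h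
  simpa [bernExp_const] using this

theorem bernExp_map (e : α ↪ β) (V : Finset α) (p : ℝ) (f : Finset β → ℝ) :
    bernExp (V.map e) p f = bernExp V p (fun A => f (A.map e)) := by
  induction V using Finset.induction_on generalizing f with
  | empty => simp [bernExp_empty]
  | insert v V hv ih =>
    rw [Finset.map_insert, bernExp_insert (by simpa using hv), bernExp_insert hv, ih, ih]
    simp only [Finset.map_insert]

theorem hasDerivAt_bernExp (V : Finset α) (f : Finset α → ℝ) (p : ℝ) :
    HasDerivAt (fun q => bernExp V q f)
      (bernExp V p fun A => ∑ v ∈ V, (f (insert v A) - f (A.erase v))) p := by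
  induction V using Finset.induction_on generalizing f with
  | empty => simpa [bernExp_empty] using hasDerivAt_const p (f ∅)
  | insert v V hv ih =>
    simp only [bernExp_insert hv]
    have h := (((hasDerivAt_const p (1 : ℝ)).sub (hasDerivAt_id p)).mul (ih f)).add
      ((hasDerivAt_id p).mul (ih fun A => f (insert v A)))
    refine h.congr_deriv ?_
    simp only [Pi.sub_apply, id]
    have e0 : bernExp V p (fun A => ∑ u ∈ insert v V, (f (insert u A) - f (A.erase u))) =
        bernExp V p (fun A => f (insert v A)) - bernExp V p f +
          bernExp V p (fun A => ∑ u ∈ V, (f (insert u A) - f (A.erase u))) := by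
      rw [← bernExp_sub, ← bernExp_add]
      refine bernExp_congr fun A hA => ?_
      rw [Finset.sum_insert hv, Finset.erase_eq_of_notMem fun h => hv (hA h)]
    have e1 : bernExp V p
        (fun A => ∑ u ∈ insert v V, (f (insert u (insert v A)) - f ((insert v A).erase u))) =
        bernExp V p (fun A => f (insert v A)) - bernExp V p f +
          bernExp V p (fun A => ∑ u ∈ V, (f (insert v (insert u A)) - f (insert v (A.erase u)))) := by
      rw [← bernExp_sub, ← bernExp_add]
      refine bernExp_congr fun A hA => ?_
      have hvA : v ∉ A := fun h => hv (hA h)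
      rw [Finset.sum_insert hv, Finset.erase_insert hvA, Finset.insert_idem]
      congr 1
      refine Finset.sum_congr rfl fun u hu => ?_
      have huv : v ≠ u := fun h => hv (h ▸ hu)
      rw [Finset.insert_comm, Finset.erase_insert_of_ne huv]
    rw [e0, e1]
    ring

/-- Russo's formula, in terms of the closed elements only. -/
theorem one_sub_mul_bernExp_sum (V : Finset α) (f : Finset α → ℝ) (p : ℝ) :
    (1 - p) * (bernExp V p fun A => ∑ v ∈ V, (f (insert v A) - f (A.erase v))) =
      bernExp V p fun A => ∑ v ∈ V \ A, (f (insert v A) - f A) := by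
  have h1 : ∀ A ⊆ V, ∑ v ∈ V \ A, (f (insert v A) - f A) =
      ∑ v ∈ V, if v ∈ A then 0 else (f (insert v A) - f A) := by
    intro A hA
    rw [Finset.sum_ite, Finset.sum_const_zero, zero_add]
    exact Finset.sum_congr (by ext; simp) fun _ _ => rfl
  rw [bernExp_congr h1, bernExp_finset_sum, bernExp_finset_sum, Finset.mul_sum]
  refine Finset.sum_congr rfl fun v hv => ?_
  obtain ⟨W, hvW, rfl⟩ : ∃ W, v ∉ W ∧ insert v W = V :=
    ⟨V.erase v, by simp, Finset.insert_erase hv⟩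
  rw [bernExp_insert hvW, bernExp_insert hvW]
  have e1 : bernExp W p (fun A => f (insert v (insert v A)) - f ((insert v A).erase v)) =
      bernExp W p (fun A => f (insert v A) - f A) :=
    bernExp_congr fun A hA => by
      rw [Finset.insert_idem, Finset.erase_insert fun h => hvW (hA h)]
  have e2 : bernExp W p (fun A => f (insert v A) - f (A.erase v)) =
      bernExp W p (fun A => f (insert v A) - f A) :=
    bernExp_congr fun A hA => by rw [Finset.erase_eq_of_notMem fun h => hvW (hA h)]
  have e3 : bernExp W p (fun A => if v ∈ A then 0 else f (insert v A) - f A) =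
      bernExp W p (fun A => f (insert v A) - f A) :=
    bernExp_congr fun A hA => by rw [if_neg fun h => hvW (hA h)]
  rw [e1, e2, e3]
  simp only [Finset.mem_insert_self, if_true, bernExp_const]
  ring

theorem continuous_bernExp (V : Finset α) (f : Finset α → ℝ) :
    Continuous fun p => bernExp V p f := by
  unfold bernExp
  fun_prop

theorem bernExp_monotoneOn (V : Finset α) {f : Finset α → ℝ} (hf : Monotone f) :
    MonotoneOn (fun p => bernExp V p f) (Set.Icc 0 1) := by
  refine monotoneOn_of_deriv_nonneg (convex_Icc 0 1) (continuous_bernExp V f).continuousOn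
    (fun p _ => (hasDerivAt_bernExp V f p).differentiableAt.differentiableWithinAt) ?_
  intro p hp
  rw [interior_Icc] at hp
  rw [(hasDerivAt_bernExp V f p).deriv]
  refine bernExp_nonneg hp.1.le hp.2.le fun A _ => Finset.sum_nonneg fun v _ => ?_
  exact sub_nonneg.2 (hf ((Finset.erase_subset _ _).trans (Finset.subset_insert _ _)))

end BernoulliExpectation

section Clusters

variable {α : Type*} (G : SimpleGraph α)

/-- The vertices that are joined to `x` by a path of `G` inside `S`. -/
def cluster (S : Set α) (x : α) : Set α :=
  {y | x ∈ S ∧ Relation.ReflTransGen (fun a b => G.Adj a b ∧ b ∈ S) x y}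

/-- The cluster of `x` in `A` contains a vertex with a neighbour outside `V`. -/
def Escapes (V A : Set α) (x : α) : Prop :=
  ∃ w ∈ cluster G A x, ∃ z ∉ V, G.Adj w z

variable {G}

theorem mem_cluster_self {S : Set α} {x : α} (hx : x ∈ S) : x ∈ cluster G S x :=
  ⟨hx, .refl⟩

theorem cluster_subset (S : Set α) (x : α) : cluster G S x ⊆ S := by
  rintro y ⟨hx, h⟩
  cases h with
  | refl => exact hx
  | tail _ h => exact h.2

theorem cluster_mono {S T : Set α} (hST : S ⊆ T) (x : α) : cluster G S x ⊆ cluster G T x :=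
  fun _ h => ⟨hST h.1, Relation.ReflTransGen.mono (fun _ _ hab => ⟨hab.1, hST hab.2⟩) _ _ h.2⟩

theorem cluster_step {S : Set α} {x y z : α} (hy : y ∈ cluster G S x) (hyz : G.Adj y z)
    (hz : z ∈ S) : z ∈ cluster G S x :=
  ⟨hy.1, hy.2.tail ⟨hyz, hz⟩⟩

theorem cluster_trans {S : Set α} {x y z : α} (hy : y ∈ cluster G S x)
    (hz : z ∈ cluster G S y) : z ∈ cluster G S x :=
  ⟨hy.1, hy.2.trans hz.2⟩

theorem cluster_induction {S : Set α} {x : α} {P : α → Prop} (hx : x ∈ S → P x)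
    (hstep : ∀ a ∈ cluster G S x, P a → ∀ b ∈ S, G.Adj a b → P b) {y : α}
    (hy : y ∈ cluster G S x) : P y := by
  obtain ⟨hxS, h⟩ := hy
  induction h with
  | refl => exact hx hxS
  | tail hab hbc ih => exact hstep _ ⟨hxS, hab⟩ ih _ hbc.2 hbc.1

theorem cluster_symm {S : Set α} {x y : α} (hy : y ∈ cluster G S x) : x ∈ cluster G S y := by
  refine cluster_induction (P := fun y => x ∈ cluster G S y) mem_cluster_self ?_ hy
  intro a ha hxa b hb hab
  exact cluster_trans (cluster_step (mem_cluster_self hb) hab.symm (cluster_subset _ _ ha)) hxa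

/-- A path leaving `V` has an initial piece inside `V`, up to its first exit. -/
theorem cluster_inter_or_exit {A V : Set α} {x y : α} (hx : x ∈ V) (hy : y ∈ cluster G A x) :
    y ∈ cluster G (A ∩ V) x ∨ ∃ w ∈ cluster G (A ∩ V) x, ∃ z ∈ A \ V, G.Adj w z := by
  refine cluster_induction (P := fun y => y ∈ cluster G (A ∩ V) x ∨
    ∃ w ∈ cluster G (A ∩ V) x, ∃ z ∈ A \ V, G.Adj w z)
    (fun hA => .inl (mem_cluster_self ⟨hA, hx⟩)) ?_ hy
  rintro a - (ha | ha) b hb hab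
  · by_cases hbV : b ∈ V
    · exact .inl (cluster_step ha hab ⟨hb, hbV⟩)
    · exact .inr ⟨a, ha, b, ⟨hb, hbV⟩, hab⟩
  · exact .inr ha

theorem Escapes.mem {V A : Set α} {x : α} (h : Escapes G V A x) : x ∈ A :=
  h.choose_spec.1.1

theorem Escapes.mono {V A B : Set α} (hAB : A ⊆ B) {x : α} (h : Escapes G V A x) :
    Escapes G V B x := by
  obtain ⟨w, hw, h⟩ := h
  exact ⟨w, cluster_mono hAB x hw, h⟩

theorem Escapes.of_mem_cluster {V A : Set α} {x y : α} (h : Escapes G V A y)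
    (hy : y ∈ cluster G A x) : Escapes G V A x := by
  obtain ⟨w, hw, h⟩ := h
  exact ⟨w, cluster_trans hy hw, h⟩

theorem Escapes.of_adj {V A : Set α} {x y : α} (h : Escapes G V A y) (hx : x ∈ A)
    (hxy : G.Adj x y) : Escapes G V A x :=
  h.of_mem_cluster (cluster_step (mem_cluster_self hx) hxy h.mem)

theorem escapes_of_adj_compl {V A : Set α} {x z : α} (hx : x ∈ A) (hz : z ∉ V)
    (hxz : G.Adj x z) : Escapes G V A x :=
  ⟨x, mem_cluster_self hx, z, hz, hxz⟩

/-- Escaping from a set `W` entails escaping from a smaller set `V`. -/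
theorem Escapes.anti {V W A : Set α} (hVW : V ⊆ W) {x : α} (hx : x ∈ V)
    (h : Escapes G W A x) : Escapes G V (A ∩ V) x := by
  obtain ⟨w, hw, z, hz, hwz⟩ := h
  obtain hw | ⟨u, hu, y, hy, huy⟩ := cluster_inter_or_exit hx hw
  · exact ⟨w, hw, z, fun h => hz (hVW h), hwz⟩
  · exact ⟨u, hu, y, hy.2, huy⟩

/-- A vertex that escapes either has a neighbour outside `V` or a neighbour that escapes. -/
theorem Escapes.adj_compl_or {V A : Set α} {x : α} (h : Escapes G V A x) :
    (∃ z ∉ V, G.Adj x z) ∨ ∃ u, Escapes G V A u ∧ G.Adj x u := by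
  obtain ⟨w, hw, z, hz, hwz⟩ := h
  have h1 := hw
  obtain ⟨hxA, hw⟩ := hw
  rcases Relation.ReflTransGen.cases_head hw with rfl | ⟨c, hc, hcw⟩
  · exact .inl ⟨z, hz, hwz⟩
  · exact .inr ⟨c, ⟨w, ⟨hc.2, hcw⟩, z, hz, hwz⟩, hc.1⟩

variable (G) in
open Classical in
/-- The vertices of `V` that are separated from the complement of `V` by the closed vertices
adjacent to it or to a vertex that escapes. -/
noncomputable def enclosed (V : Finset α) (A : Set α) : Finset α :=
  V.filter fun x => (∀ z ∉ V, ¬ G.Adj x z) ∧ ∀ u, Escapes G V A u → ¬ G.Adj x u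

theorem mem_enclosed {V : Finset α} {A : Set α} {x : α} :
    x ∈ enclosed G V A ↔
      x ∈ V ∧ (∀ z ∉ V, ¬ G.Adj x z) ∧ ∀ u, Escapes G V A u → ¬ G.Adj x u := by
  simp [enclosed]

theorem not_escapes_of_mem_enclosed {V : Finset α} {A : Set α} {x : α}
    (hx : x ∈ enclosed G V A) : ¬ Escapes G V A x := by
  intro h
  rw [mem_enclosed] at hx
  rcases h.adj_compl_or with ⟨z, hz, hxz⟩ | ⟨u, hu, hxu⟩
  · exact hx.2.1 z hz hxz
  · exact hx.2.2 u hu hxu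

theorem escapes_of_notMem_enclosed {V : Finset α} {A : Set α} {x : α} (hxA : x ∈ A)
    (hxV : x ∈ V) (hx : x ∉ enclosed G V A) : Escapes G V A x := by
  rw [mem_enclosed] at hx
  by_contra hcon
  refine hx ⟨hxV, fun z hz hxz => hcon (escapes_of_adj_compl hxA hz hxz),
    fun u hu hxu => hcon (hu.of_adj hxA hxu)⟩

theorem escapes_of_sdiff_enclosed_subset {V : Finset α} {A A' : Set α}
    (h : A \ enclosed G V A ⊆ A') {x : α} (hx : Escapes G V A x) : Escapes G V A' x := by
  obtain ⟨w, hw, z, hz, hwz⟩ := hx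
  have h0 : ∀ u, Escapes G V A u → u ∈ A' := fun u hu =>
    h ⟨hu.mem, fun hu' => not_escapes_of_mem_enclosed hu' hu⟩
  refine ⟨w, ?_, z, hz, hwz⟩
  have hw' := cluster_symm hw
  apply cluster_symm
  have hE : Escapes G V A w := escapes_of_adj_compl (cluster_subset _ _ hw) hz hwz
  refine (cluster_induction (P := fun y => y ∈ cluster G A' w ∧ Escapes G V A y)
    (fun _ => ⟨mem_cluster_self (h0 w hE), hE⟩) ?_ hw').1
  rintro a - ⟨ha, haE⟩ b hb hab
  have hbE : Escapes G V A b := haE.of_adj hb hab.symm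
  exact ⟨cluster_step ha hab (h0 b hbE), hbE⟩

/-- The enclosed set is determined by the configuration outside it. -/
theorem enclosed_eq_of_sdiff_eq {V : Finset α} {A A' : Set α} (hA' : A' ⊆ V)
    (h : A \ enclosed G V A = A' \ enclosed G V A) : enclosed G V A' = enclosed G V A := by
  have key : ∀ u, Escapes G V A' u ↔ Escapes G V A u := by
    intro u
    constructor
    · rintro ⟨w, hw, z, hz, hwz⟩
      have hw' := cluster_symm hw
      have hmem : ∀ y ∈ A', y ∉ enclosed G V A → Escapes G V A y := fun y hy hy' =>
        escapes_of_notMem_enclosed (h.symm.subset ⟨hy, hy'⟩).1 (hA' hy) hy'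
      refine cluster_induction (P := fun y => Escapes G V A y) (fun hwA => ?_) ?_ hw'
      · exact hmem w hwA fun hw => (mem_enclosed.1 hw).2.1 z hz hwz
      · intro a _ ha b hb hab
        exact hmem b hb fun hb => (mem_enclosed.1 hb).2.2 a ha hab.symm
    · exact escapes_of_sdiff_enclosed_subset (h.subset.trans Set.sdiff_subset)
  ext x
  simp only [mem_enclosed, key]

end Clusters

section Sharpness

variable {α : Type*} (G : SimpleGraph α)

/-- The indicator function, on finite configurations, of a property. -/
noncomputable def ind (P : Finset α → Prop) (A : Finset α) : ℝ :=
  open Classical in if P A then 1 else 0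

theorem ind_of {P : Finset α → Prop} {A : Finset α} (h : P A) : ind P A = 1 := if_pos h

theorem ind_of_not {P : Finset α → Prop} {A : Finset α} (h : ¬ P A) : ind P A = 0 := if_neg h

theorem ind_nonneg (P : Finset α → Prop) (A : Finset α) : 0 ≤ ind P A := by
  unfold ind; split_ifs <;> norm_num

theorem ind_le_one (P : Finset α → Prop) (A : Finset α) : ind P A ≤ 1 := by
  unfold ind; split_ifs <;> norm_num

theorem ind_mono {P Q : Finset α → Prop} {A B : Finset α} (h : P A → Q B) :
    ind P A ≤ ind Q B := by
  by_cases hP : P A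
  · rw [ind_of hP, ind_of (h hP)]
  · rw [ind_of_not hP]; exact ind_nonneg _ _

variable {G} in
theorem monotone_ind_escapes (V : Finset α) (o : α) :
    Monotone (ind fun A : Finset α => Escapes G V A o) := fun _ _ hAB =>
  ind_mono fun h => h.mono (Finset.coe_subset.2 hAB)

variable [DecidableEq α]

/-- The probability that `o` is joined to the complement of `V` by a path with open vertices
in `V`. -/
noncomputable def escapeProb (V : Finset α) (p : ℝ) (o : α) : ℝ :=
  bernExp V p (ind fun A => Escapes G V A o)

/-- The vertices outside `S` that are adjacent to the cluster of `o` in `B`. -/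
def exitSet (S : Finset α) (B : Set α) (o : α) : Set α :=
  {v | v ∉ S ∧ ∃ x ∈ cluster G B o, G.Adj x v}

/-- The expected number of vertices outside `S` adjacent to the cluster of `o` in `S`. -/
noncomputable def exitExp (S : Finset α) (p : ℝ) (o : α) : ℝ :=
  bernExp S p fun B => ((exitSet G S B o).ncard : ℝ)

variable {G}

theorem escapes_insert_of_mem_exitSet {V A : Finset α} {o v : α}
    (hv : v ∈ exitSet G (enclosed G V A) ((A ∩ enclosed G V A : Finset α) : Set α) o) :
    v ∈ V \ A ∧ Escapes G V (insert v A : Finset α) o := by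
  obtain ⟨hvS, x, hx, hxv⟩ := hv
  have hxS : x ∈ A ∧ x ∈ enclosed G V A := by simpa using cluster_subset _ _ hx
  have hxS' := mem_enclosed.1 hxS.2
  have hvV : v ∈ V := by
    by_contra h
    exact hxS'.2.1 v (by simpa using h) hxv
  have hvA : v ∉ A := fun h =>
    hxS'.2.2 v (escapes_of_notMem_enclosed (by simpa using h) hvV hvS) hxv
  refine ⟨by simp [hvV, hvA], ?_⟩
  have hsub : (A : Set α) ⊆ (insert v A : Finset α) := by simp
  have hvE : Escapes G V (insert v A : Finset α) v := by
    by_contra hcon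
    refine hvS (mem_enclosed.2 ⟨hvV, fun z hz hvz => ?_, fun u hu hvu => ?_⟩)
    · exact hcon (escapes_of_adj_compl (by simp) hz hvz)
    · exact hcon ((hu.mono hsub).of_adj (by simp) hvu)
  have hx' : x ∈ cluster G ((insert v A : Finset α) : Set α) o :=
    cluster_mono (by simp only [Finset.coe_inter]; exact Set.inter_subset_left.trans hsub) o hx
  exact hvE.of_mem_cluster (cluster_step hx' hxv (by simp))

theorem ncard_exitSet_le {V A : Finset α} {o : α} (ho : o ∈ enclosed G V A) :
    ((exitSet G (enclosed G V A) ((A ∩ enclosed G V A : Finset α) : Set α) o).ncard : ℝ) ≤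
      ∑ v ∈ V \ A, (ind (fun A => Escapes G V A o) (insert v A) -
        ind (fun A => Escapes G V A o) A) := by
  classical
  rw [ind_of_not (P := fun A : Finset α => Escapes G V A o) (not_escapes_of_mem_enclosed ho)]
  simp only [sub_zero]
  have h1 : ∑ v ∈ V \ A, ind (fun A : Finset α => Escapes G V A o) (insert v A) =
      (((V \ A).filter fun v => Escapes G V (insert v A : Finset α) o).card : ℝ) := by
    rw [Finset.card_filter]
    push_cast
    exact Finset.sum_congr rfl fun v _ => by simp [ind]
  rw [h1, ← Set.ncard_coe_finset]
  refine mod_cast Set.ncard_le_ncard (fun v hv => ?_) (Finset.finite_toSet _)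
  simpa [and_assoc] using escapes_insert_of_mem_exitSet hv

theorem one_sub_ind_escapes_le {V A : Finset α} {o : α} (ho : o ∈ V)
    (hoS : o ∉ enclosed G V A) :
    1 - ind (fun A : Finset α => Escapes G V A o) A ≤
      ∑ v ∈ V \ A, (ind (fun A : Finset α => Escapes G V A o) (insert v A) -
        ind (fun A : Finset α => Escapes G V A o) A) := by
  by_cases hE : Escapes G V A o
  · rw [ind_of (P := fun A : Finset α => Escapes G V A o) hE, sub_self]
    exact Finset.sum_nonneg fun v _ => sub_nonneg.2 <| by
      rw [ind_of (P := fun A : Finset α => Escapes G V A o)]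
      exact hE.mono (by simp)
  · have hoA : o ∉ A := fun h => hE (escapes_of_notMem_enclosed (by simpa using h) ho hoS)
    have hins : Escapes G V (insert o A : Finset α) o := by
      by_contra hcon
      refine hoS (mem_enclosed.2 ⟨ho, fun z hz hvz => ?_, fun u hu hvu => ?_⟩)
      · exact hcon (escapes_of_adj_compl (by simp) hz hvz)
      · exact hcon ((hu.mono (by simp)).of_adj (by simp) hvu)
    have h1 := Finset.single_le_sum (f := fun v =>
      ind (fun A : Finset α => Escapes G V A o) (insert v A) -
        ind (fun A : Finset α => Escapes G V A o) A)
      (fun v _ => sub_nonneg.2 (monotone_ind_escapes V o (Finset.subset_insert _ _)))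
      (Finset.mem_sdiff.2 ⟨ho, hoA⟩)
    rwa [ind_of (P := fun A : Finset α => Escapes G V A o) hins] at h1

/-- If every finite set containing `o` has at least one exit on average, then the escape probability
`f` satisfies `1 - f ≤ (1 - p) f'`. -/
theorem one_sub_escapeProb_le {V : Finset α} {o : α} (ho : o ∈ V) {p : ℝ} (h0 : 0 ≤ p)
    (h1 : p ≤ 1) (hφ : ∀ S : Finset α, o ∈ S → 1 ≤ exitExp G S p o) :
    1 - escapeProb G V p o ≤
      bernExp V p fun A => ∑ v ∈ V \ A, (ind (fun A : Finset α => Escapes G V A o) (insert v A) -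
        ind (fun A : Finset α => Escapes G V A o) A) := by
  set f := ind (fun A : Finset α => Escapes G V A o) with hf
  set N : Finset α → ℝ := fun A => ∑ v ∈ V \ A, (f (insert v A) - f A) with hN
  set I := ind (fun A : Finset α => o ∈ enclosed G V A) with hI
  have hpt : ∀ A ⊆ V, 1 - f A ≤ I A + (1 - I A) * N A := by
    intro A hA
    by_cases hoS : o ∈ enclosed G V A
    · rw [hI, ind_of (P := fun A : Finset α => o ∈ enclosed G V A) hoS]
      have := ind_nonneg (fun A : Finset α => Escapes G V A o) A
      simp only [sub_self, zero_mul, add_zero]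
      linarith
    · rw [hI, ind_of_not (P := fun A : Finset α => o ∈ enclosed G V A) hoS]
      rw [zero_add, sub_zero, one_mul]
      exact one_sub_ind_escapes_le ho hoS
  let J : Finset α → Finset α → ℝ := fun S => ind fun A => enclosed G V A = S
  have hIJ : ∀ A ⊆ V, ∀ c : ℝ, I A * c = ∑ S ∈ V.powerset.filter (o ∈ ·), J S A * c := by
    intro A hA c
    rw [← Finset.sum_mul]
    congr 1
    by_cases hoS : o ∈ enclosed G V A
    · rw [hI, ind_of (P := fun A : Finset α => o ∈ enclosed G V A) hoS,
        Finset.sum_eq_single (enclosed G V A)]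
      · exact (ind_of (P := fun B : Finset α => enclosed G V B = enclosed G V A) rfl).symm
      · intro S _ hS
        exact ind_of_not (P := fun B : Finset α => enclosed G V B = S) fun h => hS h.symm
      · intro h
        refine absurd (Finset.mem_filter.2 ⟨Finset.mem_powerset.2 ?_, hoS⟩) h
        exact fun x hx => (mem_enclosed.1 hx).1
    · rw [hI, ind_of_not (P := fun A : Finset α => o ∈ enclosed G V A) hoS]
      refine (Finset.sum_eq_zero fun S hS => ?_).symm
      refine ind_of_not (P := fun B : Finset α => enclosed G V B = S) fun h => hoS ?_
      rw [h]; exact (Finset.mem_filter.1 hS).2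
  have hJ : ∀ S ⊆ V, ∀ A ⊆ V, J S A = J S (A \ S) := by
    intro S hS A hA
    have key : ∀ A B : Finset α, B ⊆ V → A \ S = B \ S → enclosed G V A = S →
        enclosed G V B = S := by
      intro A B hB hAB h
      rw [← h]
      refine enclosed_eq_of_sdiff_eq (by simpa using hB) ?_
      rw [h]
      exact_mod_cast hAB
    refine le_antisymm (ind_mono ?_) (ind_mono ?_)
    · exact key A (A \ S) (Finset.sdiff_subset.trans hA) (by simp)
    · exact key (A \ S) A hA (by simp)
  have hstep : bernExp V p I ≤ bernExp V p (fun A => I A * N A) := by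
    have e1 : bernExp V p I = ∑ S ∈ V.powerset.filter (o ∈ ·), bernExp V p (J S) := by
      rw [← bernExp_finset_sum]
      exact bernExp_congr fun A hA => by simpa using hIJ A hA 1
    have e2 : bernExp V p (fun A => I A * N A) =
        ∑ S ∈ V.powerset.filter (o ∈ ·), bernExp V p (fun A => J S A * N A) := by
      rw [← bernExp_finset_sum]
      exact bernExp_congr fun A hA => hIJ A hA _
    rw [e1, e2]
    refine Finset.sum_le_sum fun S hS => ?_
    obtain ⟨hSV, hoS⟩ := Finset.mem_filter.1 hS
    rw [Finset.mem_powerset] at hSV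
    calc bernExp V p (J S) = bernExp (V \ S) p (J S) := by
          rw [← bernExp_sdiff hSV]; exact bernExp_congr (hJ S hSV)
      _ ≤ exitExp G S p o * bernExp (V \ S) p (J S) :=
          le_mul_of_one_le_left (bernExp_nonneg h0 h1 fun A _ => ind_nonneg _ _) (hφ S hoS)
      _ = bernExp V p (fun A => ((exitSet G S (A ∩ S : Finset α) o).ncard : ℝ) * J S (A \ S)) :=
          (bernExp_split hSV p (fun B => ((exitSet G S B o).ncard : ℝ)) (J S)).symm
      _ ≤ bernExp V p (fun A => J S A * N A) := by
          refine bernExp_mono h0 h1 fun A hA => ?_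
          rw [← hJ S hSV A hA, mul_comm]
          by_cases hAS : enclosed G V A = S
          · refine mul_le_mul_of_nonneg_left ?_ (ind_nonneg _ _)
            subst hAS
            exact ncard_exitSet_le hoS
          · have : J S A = 0 := ind_of_not (P := fun B : Finset α => enclosed G V B = S) hAS
            simp [this]
  calc 1 - escapeProb G V p o = bernExp V p (fun A => 1 - f A) := by
        rw [bernExp_sub, bernExp_const]; rfl
    _ ≤ bernExp V p (fun A => I A + (1 - I A) * N A) := bernExp_mono h0 h1 hpt
    _ = bernExp V p (fun A => I A + (N A - I A * N A)) := by
        congr 1; ext A; ring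
    _ = bernExp V p I + (bernExp V p N - bernExp V p (fun A => I A * N A)) := by
        rw [bernExp_add, bernExp_sub]
    _ ≤ bernExp V p N := by linarith

/-- The lower bound on escape probabilities above the threshold for `exitExp`. -/
theorem le_escapeProb {V : Finset α} {o : α} (ho : o ∈ V) {p p' : ℝ} (h0 : 0 ≤ p) (hpp : p < p')
    (h1 : p' < 1) (hφ : ∀ q ∈ Set.Ioo p p', ∀ S : Finset α, o ∈ S → 1 ≤ exitExp G S q o) :
    (p' - p) / (1 - p) ≤ escapeProb G V p' o := by
  set f : Finset α → ℝ := ind fun A => Escapes G V A o with hf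
  have hanti : AntitoneOn (fun q => (1 - bernExp V q f) / (1 - q)) (Set.Icc p p') := by
    have hd : ∀ q ∈ Set.Icc p p', HasDerivAt (fun q => (1 - bernExp V q f) / (1 - q))
        ((-(bernExp V q fun A => ∑ v ∈ V, (f (insert v A) - f (A.erase v))) * (1 - q) -
          (1 - bernExp V q f) * (-1)) / (1 - q) ^ 2) q := by
      intro q hq
      have hq1 : (1 - q) ≠ 0 := by have := hq.2; linarith
      have a1 := (hasDerivAt_bernExp V f q).const_sub 1
      have a2 := (hasDerivAt_id q).const_sub 1
      exact a1.div a2 hq1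
    refine antitoneOn_of_deriv_nonpos (convex_Icc _ _)
      (fun q hq => (hd q hq).continuousAt.continuousWithinAt) ?_ ?_
    · intro q hq
      exact (hd q (interior_subset hq)).differentiableAt.differentiableWithinAt
    · intro q hq
      rw [(hd q (interior_subset hq)).deriv]
      rw [interior_Icc] at hq
      refine div_nonpos_of_nonpos_of_nonneg ?_ (sq_nonneg _)
      have h2 := one_sub_escapeProb_le ho (h0.trans hq.1.le) (hq.2.trans h1).le (hφ q hq)
      rw [← one_sub_mul_bernExp_sum] at h2
      simp only [escapeProb] at h2
      linarith
  have h2 := hanti (Set.left_mem_Icc.2 hpp.le) (Set.right_mem_Icc.2 hpp.le) hpp.le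
  have hfp : 0 ≤ bernExp V p f :=
    bernExp_nonneg h0 (hpp.trans h1).le fun A _ => ind_nonneg _ _
  have h3 : (1 - bernExp V p' f) / (1 - p') ≤ 1 / (1 - p) :=
    h2.trans (div_le_div_of_nonneg_right (by linarith) (by linarith))
  have hp1 : 0 < 1 - p := by linarith
  rw [div_le_div_iff₀ (by linarith) hp1] at h3
  rw [div_le_iff₀ hp1]
  change p' - p ≤ bernExp V p' f * (1 - p)
  linarith

end Sharpness

section Decay

variable {α : Type*} {G : SimpleGraph α}

/-- Whether the cluster of `o` in `A ∩ S` is `C` depends only on `C` and the vertices of `S`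
adjacent to it. -/
theorem cluster_eq_of_inter_eq {A A' S C : Set α} {o : α} (ho : o ∈ C)
    (hAA : ∀ x ∈ S, (x ∈ C ∨ ∃ c ∈ C, G.Adj c x) → (x ∈ A ↔ x ∈ A'))
    (hC : cluster G (A ∩ S) o = C) : cluster G (A' ∩ S) o = C := by
  have hCA : ∀ x ∈ C, x ∈ A ∩ S := fun x hx => cluster_subset _ _ (hC.symm.subset hx)
  have hCA' : ∀ x ∈ C, x ∈ A' ∩ S := fun x hx =>
    ⟨(hAA x (hCA x hx).2 (.inl hx)).1 (hCA x hx).1, (hCA x hx).2⟩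
  refine Set.Subset.antisymm (fun y hy => ?_) (fun y hy => ?_)
  · refine cluster_induction (P := fun y => y ∈ C) (fun _ => ho) ?_ hy
    intro a _ ha b hb hab
    rw [← hC] at ha ⊢
    refine cluster_step ha hab ⟨(hAA b hb.2 (.inr ⟨a, hC.subset ha, hab⟩)).2 hb.1, hb.2⟩
  · have hy' := hC.symm.subset hy
    refine (cluster_induction (P := fun y => y ∈ C ∧ y ∈ cluster G (A' ∩ S) o)
      (fun _ => ⟨ho, mem_cluster_self (hCA' o ho)⟩) ?_ hy').2
    rintro a - ⟨ha, ha'⟩ b hb hab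
    have hbC : b ∈ C := by
      rw [← hC] at ha ⊢
      exact cluster_step ha hab hb
    exact ⟨hbC, cluster_step ha' hab (hCA' b hbC)⟩

/-- A path that escapes from `V` leaves the cluster `C` of its starting point in `S` for good at
some vertex outside `S`. -/
theorem Escapes.exists_escapes_off {V A S C : Set α} {o : α} (hAV : A ⊆ V)
    (hSV : ∀ x ∈ S, ∀ z, G.Adj x z → z ∈ V) (ho : o ∈ S) (h : Escapes G V A o)
    (hC : cluster G (A ∩ S) o = C) :
    ∃ y ∈ V \ S, (∃ x ∈ C, G.Adj x y) ∧
      Escapes G V (A \ {x ∈ S | x ∈ C ∨ ∃ c ∈ C, G.Adj c x}) y := by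
  have hoC : o ∈ C := hC ▸ mem_cluster_self ⟨h.mem, ho⟩
  obtain ⟨w, hw, z, hz, hwz⟩ := h
  set T : Set α := {x ∈ S | x ∈ C ∨ ∃ c ∈ C, G.Adj c x} with hT
  have hAC : ∀ b ∈ A, b ∈ T → b ∈ C := by
    rintro b hb ⟨hbS, hbC | ⟨c, hc, hcb⟩⟩
    · exact hbC
    · rw [← hC] at hc ⊢
      exact cluster_step hc hcb ⟨hb, hbS⟩
  have key : w ∈ C ∨ ∃ y ∈ V \ S, (∃ x ∈ C, G.Adj x y) ∧ w ∈ cluster G (A \ T) y := by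
    refine cluster_induction (P := fun w => w ∈ C ∨ ∃ y ∈ V \ S, (∃ x ∈ C, G.Adj x y) ∧
      w ∈ cluster G (A \ T) y) (fun _ => .inl hoC) ?_ hw
    intro a _ ha b hb hab
    by_cases hbC : b ∈ C
    · exact .inl hbC
    have hbT : b ∈ A \ T := ⟨hb, fun h => hbC (hAC b hb h)⟩
    rcases ha with ha | ⟨y, hy, hxy, hay⟩
    · have hbS : b ∉ S := fun hbS => hbT.2 ⟨hbS, .inr ⟨a, ha, hab⟩⟩
      exact .inr ⟨b, ⟨hAV hb, hbS⟩, ⟨a, ha, hab⟩, mem_cluster_self hbT⟩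
    · exact .inr ⟨y, hy, hxy, cluster_step hay hab hbT⟩
  rcases key with hwC | ⟨y, hy, hxy, hwy⟩
  · rw [← hC] at hwC
    exact absurd (hSV w (cluster_subset _ _ hwC).2 z hwz) hz
  · exact ⟨y, hy, hxy, w, hwy, z, hz, hwz⟩

variable [DecidableEq α]

theorem escapeProb_le_one (V : Finset α) {p : ℝ} (h0 : 0 ≤ p) (h1 : p ≤ 1) (o : α) :
    escapeProb G V p o ≤ 1 := by
  rw [← bernExp_const V p 1]
  exact bernExp_mono h0 h1 fun _ _ => ind_le_one _ _

theorem exitExp_nonneg (S : Finset α) {p : ℝ} (h0 : 0 ≤ p) (h1 : p ≤ 1) (o : α) :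
    0 ≤ exitExp G S p o :=
  bernExp_nonneg h0 h1 fun _ _ => Nat.cast_nonneg _

theorem escapeProb_le_of_subset {V W : Finset α} (hVW : V ⊆ W) {p : ℝ} (h0 : 0 ≤ p) (h1 : p ≤ 1)
    {o : α} (ho : o ∈ V) : escapeProb G W p o ≤ escapeProb G V p o := by
  unfold escapeProb
  rw [← bernExp_inter hVW p (ind fun A => Escapes G V A o)]
  refine bernExp_mono h0 h1 fun A _ => ind_mono fun h => ?_
  rw [Finset.coe_inter]
  exact h.anti (by exact_mod_cast hVW) (by exact_mod_cast ho)

theorem escapeProb_le_exitExp_mul {V S : Finset α} {o : α} (hS : S ⊆ V)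
    (hSV : ∀ x ∈ S, ∀ z, G.Adj x z → z ∈ V) (ho : o ∈ S) {p c : ℝ} (h0 : 0 ≤ p) (h1 : p ≤ 1)
    (hc : ∀ y ∈ V \ S, (∃ x ∈ S, G.Adj x y) → escapeProb G V p y ≤ c) :
    escapeProb G V p o ≤ exitExp G S p o * c := by
  classical
  let T : Finset α → Finset α := fun C => S.filter fun x => x ∈ C ∨ ∃ c ∈ C, G.Adj c x
  let Y : Finset α → Finset α := fun C => (V \ S).filter fun y => ∃ x ∈ C, G.Adj x y
  let J : Finset α → Finset α → ℝ := fun C => ind fun B => cluster G (B ∩ S) o = C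
  let F : α → Finset α → ℝ := fun y => ind fun A => Escapes G V A y
  let K := S.powerset.filter (o ∈ ·)
  have hTS : ∀ C, T C ⊆ S := fun C => Finset.filter_subset _ _
  have hJT : ∀ C ∈ K, ∀ A : Finset α, J C (A ∩ T C) = J C A := by
    intro C hC A
    have hoC : o ∈ (C : Set α) := by exact_mod_cast (Finset.mem_filter.1 hC).2
    refine le_antisymm (ind_mono fun h => ?_) (ind_mono fun h => ?_)
    · refine cluster_eq_of_inter_eq hoC (fun x hx hxC => ?_) h
      simp only [Finset.mem_coe] at hx hxC
      simp [T, hx, hxC]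
    · refine cluster_eq_of_inter_eq hoC (fun x hx hxC => ?_) h
      simp only [Finset.mem_coe] at hx hxC
      simp [T, hx, hxC]
  have hJS : ∀ C, ∀ A : Finset α, J C (A ∩ S) = J C A := by
    intro C A
    simp [J, ind, Set.inter_assoc]
  have hpt : ∀ A ⊆ V, F o A ≤ ∑ C ∈ K, J C (A ∩ T C) * ∑ y ∈ Y C, F y (A \ T C) := by
    intro A hA
    by_cases hE : Escapes G V A o
    · let C : Finset α := S.filter (· ∈ cluster G (A ∩ S) o)
      have hC : cluster G (A ∩ S) o = C := by
        ext x
        simp only [C, Finset.coe_filter]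
        exact ⟨fun hx => ⟨(cluster_subset _ _ hx).2, hx⟩, fun hx => hx.2⟩
      have hCK : C ∈ K := by
        simp only [K, Finset.mem_filter, Finset.mem_powerset, C]
        exact ⟨Finset.filter_subset _ _, ho, mem_cluster_self ⟨hE.mem, ho⟩⟩
      obtain ⟨y, hy, hxy, hyE⟩ := hE.exists_escapes_off (by exact_mod_cast hA)
        (by simpa using hSV) (by exact_mod_cast ho) hC
      have hyY : y ∈ Y C := by
        simp only [Y, Finset.mem_filter, Finset.mem_sdiff]
        exact ⟨by simpa using hy, by simpa using hxy⟩
      have hFy : F y (A \ T C) = 1 := ind_of (P := fun A : Finset α => Escapes G V A y) (by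
        convert hyE using 1
        simp [T])
      have hJC : J C (A ∩ T C) = 1 := by
        rw [hJT C hCK]
        exact ind_of (P := fun B : Finset α => cluster G (B ∩ S) o = C) hC
      calc F o A ≤ 1 := ind_le_one _ _
        _ = J C (A ∩ T C) * F y (A \ T C) := by rw [hFy, hJC, one_mul]
        _ ≤ J C (A ∩ T C) * ∑ y ∈ Y C, F y (A \ T C) :=
          mul_le_mul_of_nonneg_left (Finset.single_le_sum
            (f := fun y => F y (A \ T C)) (fun _ _ => ind_nonneg _ _) hyY) (ind_nonneg _ _)
        _ ≤ _ := Finset.single_le_sum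
          (f := fun C => J C (A ∩ T C) * ∑ y ∈ Y C, F y (A \ T C))
          (fun _ _ => mul_nonneg (ind_nonneg _ _) (Finset.sum_nonneg fun _ _ => ind_nonneg _ _))
          hCK
    · rw [show F o A = 0 from ind_of_not (P := fun A : Finset α => Escapes G V A o) hE]
      exact Finset.sum_nonneg fun _ _ => mul_nonneg (ind_nonneg _ _)
        (Finset.sum_nonneg fun _ _ => ind_nonneg _ _)
  have hY : ∀ C ∈ K, ∀ B ⊆ S, J C B * ((Y C).card : ℝ) =
      J C B * ((exitSet G S B o).ncard : ℝ) := by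
    intro C hC B hB
    by_cases hBC : cluster G (B ∩ S) o = C
    · have hBS : (B : Set α) ∩ S = B := Set.inter_eq_left.2 (by exact_mod_cast hB)
      rw [hBS] at hBC
      congr 2
      rw [← Set.ncard_coe_finset]
      congr 1
      ext y
      simp only [exitSet, hBC, Y, Finset.coe_filter, Finset.mem_sdiff, Finset.mem_coe]
      constructor
      · rintro ⟨h1, h2⟩; exact ⟨h1.2, h2⟩
      · rintro ⟨h1, x, hx, hxy⟩
        refine ⟨⟨hSV x ?_ y hxy, h1⟩, x, hx, hxy⟩
        exact Finset.mem_powerset.1 (Finset.mem_filter.1 hC).1 hx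
    · rw [show J C B = 0 from
        ind_of_not (P := fun B : Finset α => cluster G (B ∩ S) o = C) hBC, zero_mul, zero_mul]
  have hexit : ∑ C ∈ K, bernExp S p (J C) * (Y C).card ≤ exitExp G S p o := by
    have : ∀ C ∈ K, bernExp S p (J C) * (Y C).card =
        bernExp S p fun B => J C B * ((exitSet G S B o).ncard : ℝ) := by
      intro C hC
      rw [← bernExp_mul_const]
      exact bernExp_congr (hY C hC)
    rw [Finset.sum_congr rfl this, ← bernExp_finset_sum]
    refine bernExp_mono h0 h1 fun B _ => ?_
    rw [← Finset.sum_mul]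
    refine mul_le_of_le_one_left (Nat.cast_nonneg _) ?_
    by_cases h : ∃ C ∈ K, J C B ≠ 0
    · obtain ⟨C, hC, hCB⟩ := h
      have hBC : cluster G (B ∩ S) o = C := by
        by_contra h
        exact hCB (ind_of_not (P := fun B : Finset α => cluster G (B ∩ S) o = C) h)
      rw [Finset.sum_eq_single_of_mem C hC]
      · exact ind_le_one _ _
      · intro C' _ hC'
        refine ind_of_not (P := fun B : Finset α => cluster G (B ∩ S) o = C') fun h => hC' ?_
        rw [hBC] at h
        exact_mod_cast h.symm
    · push Not at h
      rw [Finset.sum_eq_zero h]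
      exact zero_le_one
  have hc' : ∀ C ∈ K, ∀ y ∈ Y C, bernExp (V \ T C) p (F y) ≤ c := by
    intro C hC y hy
    obtain ⟨hyV, x, hx, hxy⟩ := Finset.mem_filter.1 hy
    refine le_trans ?_ (hc y hyV ⟨x, Finset.mem_powerset.1 (Finset.mem_filter.1 hC).1 hx, hxy⟩)
    rw [← bernExp_sdiff ((hTS C).trans hS)]
    exact bernExp_mono h0 h1 fun A _ => monotone_ind_escapes V y Finset.sdiff_subset
  by_cases hc0 : ∃ C ∈ K, (Y C).Nonempty
  · have hc1 : 0 ≤ c := by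
      obtain ⟨C, hC, y, hy⟩ := hc0
      exact (bernExp_nonneg h0 h1 fun _ _ => ind_nonneg _ _).trans (hc' C hC y hy)
    calc escapeProb G V p o
        ≤ bernExp V p fun A => ∑ C ∈ K, J C (A ∩ T C) * ∑ y ∈ Y C, F y (A \ T C) :=
          bernExp_mono h0 h1 hpt
      _ = ∑ C ∈ K, bernExp (T C) p (J C) * ∑ y ∈ Y C, bernExp (V \ T C) p (F y) := by
          rw [bernExp_finset_sum]
          refine Finset.sum_congr rfl fun C _ => ?_
          rw [bernExp_split ((hTS C).trans hS) p (J C) (fun B => ∑ y ∈ Y C, F y B),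
            bernExp_finset_sum]
      _ = ∑ C ∈ K, bernExp S p (J C) * ∑ y ∈ Y C, bernExp (V \ T C) p (F y) := by
          refine Finset.sum_congr rfl fun C hC => ?_
          rw [← bernExp_inter (hTS C)]
          congr 2
          ext A
          exact hJT C hC A
      _ ≤ ∑ C ∈ K, bernExp S p (J C) * ((Y C).card * c) := by
          refine Finset.sum_le_sum fun C hC => mul_le_mul_of_nonneg_left ?_
            (bernExp_nonneg h0 h1 fun _ _ => ind_nonneg _ _)
          rw [← nsmul_eq_mul]
          exact Finset.sum_le_card_nsmul _ _ _ (hc' C hC)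
      _ = (∑ C ∈ K, bernExp S p (J C) * (Y C).card) * c := by
          rw [Finset.sum_mul]
          exact Finset.sum_congr rfl fun C _ => by ring
      _ ≤ exitExp G S p o * c := mul_le_mul_of_nonneg_right hexit hc1
  · push Not at hc0
    have hzero : ∀ B ⊆ S, ((exitSet G S B o).ncard : ℝ) = 0 := by
      intro B hB
      rw [Nat.cast_eq_zero]
      have : exitSet G S B o = ∅ := by
        rw [Set.eq_empty_iff_forall_notMem]
        rintro y ⟨hyS, x, hx, hxy⟩
        have hBS : ∀ b ∈ B, b ∈ S := hB
        let C : Finset α := S.filter (· ∈ cluster G B o)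
        have hCK : C ∈ K := by
          simp only [K, Finset.mem_filter, Finset.mem_powerset, C]
          exact ⟨Finset.filter_subset _ _, ho, mem_cluster_self hx.1⟩
        have hxS : x ∈ S := hBS x (by simpa using cluster_subset _ _ hx)
        have : y ∈ Y C := by
          simp only [Y, Finset.mem_filter, Finset.mem_sdiff]
          exact ⟨⟨hSV x hxS y hxy, by simpa using hyS⟩, x, by simp [C, hxS, hx], hxy⟩
        simp [hc0 C hCK] at this
      simp [this]
    have h2 : exitExp G S p o = 0 := by
      unfold exitExp
      rw [bernExp_congr hzero, bernExp_const]
    rw [h2, zero_mul, ← bernExp_const V p 0]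
    refine bernExp_mono h0 h1 fun A hA => (hpt A hA).trans ?_
    refine (Finset.sum_eq_zero fun C hC => ?_).le
    rw [hc0 C hC, Finset.sum_empty, mul_zero]

end Decay

section Lattice

variable {d : ℕ}

/-- The box of radius `r` around `y` in `ℤ^d`. -/
noncomputable def latticeBox (y : Fin d → ℤ) (r : ℕ) : Finset (Fin d → ℤ) :=
  Finset.Icc (fun i => y i - r) (fun i => y i + r)

theorem mem_latticeBox {y x : Fin d → ℤ} {r : ℕ} :
    x ∈ latticeBox y r ↔ ∀ i, |x i - y i| ≤ r := by
  simp only [latticeBox, Finset.mem_Icc, Pi.le_def, ← forall_and, abs_le]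
  exact forall_congr' fun i => by constructor <;> rintro ⟨h1, h2⟩ <;> constructor <;> linarith

theorem self_mem_latticeBox (y : Fin d → ℤ) (r : ℕ) : y ∈ latticeBox y r := by
  simp [mem_latticeBox]

theorem latticeBox_subset {x y : Fin d → ℤ} {r s n : ℕ} (hx : x ∈ latticeBox y s)
    (h : r + s ≤ n) : latticeBox x r ⊆ latticeBox y n := by
  intro z hz
  rw [mem_latticeBox] at *
  intro i
  have h1 := hx i
  have h2 := hz i
  have h3 : ((r : ℤ) + s) ≤ n := by exact_mod_cast h
  rw [abs_le] at *
  constructor <;> linarith [h1.1, h1.2, h2.1, h2.2]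

theorem mem_latticeBox_succ_of_adj {x y z : Fin d → ℤ} {r : ℕ} (hx : x ∈ latticeBox y r)
    (hxz : (latticeL d).Adj x z) : z ∈ latticeBox y (r + 1) := by
  rw [mem_latticeBox] at *
  intro i
  have h1 := hx i
  have h2 := hxz.2.1 i
  push_cast
  rw [abs_le] at *
  constructor <;> linarith [h1.1, h1.2, h2.1, h2.2]

theorem exists_subset_latticeBox (S : Finset (Fin d → ℤ)) (y : Fin d → ℤ) :
    ∃ r, S ⊆ latticeBox y r := by
  refine ⟨S.sup fun x => Finset.univ.sup fun i => (x i - y i).natAbs, fun x hx => ?_⟩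
  rw [mem_latticeBox]
  intro i
  have h1 : (x i - y i).natAbs ≤ Finset.univ.sup fun i => (x i - y i).natAbs :=
    Finset.le_sup (f := fun i => (x i - y i).natAbs) (Finset.mem_univ i)
  have h2 := Finset.le_sup (f := fun x => Finset.univ.sup fun i => (x i - y i).natAbs) hx
  rw [Int.abs_eq_natAbs]
  exact_mod_cast h1.trans h2

theorem escapeProb_latticeBox_le {p : ℝ} (h0 : 0 ≤ p) (h1 : p ≤ 1) (y : Fin d → ℤ) (r : ℕ) :
    escapeProb (latticeL d) (latticeBox y r) p y ≤
      escapeProb (latticeL d) (latticeBox 0 r) p 0 := by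
  let e : (Fin d → ℤ) ↪ (Fin d → ℤ) := (Equiv.subRight y).toEmbedding
  have he : ∀ x, e x = x - y := fun _ => rfl
  have hbox : latticeBox 0 r = (latticeBox y r).map e := by
    ext x
    simp only [Finset.mem_map, he, mem_latticeBox]
    constructor
    · intro h
      exact ⟨x + y, by simpa using h, by simp⟩
    · rintro ⟨z, hz, rfl⟩
      simpa using hz
  have hadj : ∀ a b, (latticeL d).Adj a b → (latticeL d).Adj (a - y) (b - y) := by
    rintro a b ⟨h1, h2, i, h3⟩
    exact ⟨by simpa using h1, fun i => by simpa using h2 i, i, by simp [h3]⟩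
  have hcl : ∀ (A : Finset (Fin d → ℤ)) (w), w ∈ cluster (latticeL d) A y →
      w - y ∈ cluster (latticeL d) ((A.map e : Finset (Fin d → ℤ)) : Set (Fin d → ℤ)) 0 := by
    intro A w hw
    have hA : ∀ a ∈ A, a - y ∈ A.map e := fun a ha => Finset.mem_map.2 ⟨a, ha, rfl⟩
    refine cluster_induction (P := fun w => w - y ∈ cluster (latticeL d)
      ((A.map e : Finset (Fin d → ℤ)) : Set (Fin d → ℤ)) 0) (fun hy => ?_) ?_ hw
    · rw [sub_self]
      exact mem_cluster_self (by simpa using hA y hy)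
    · intro a _ ha b hb hab
      exact cluster_step ha (hadj a b hab) (by exact_mod_cast hA b hb)
  unfold escapeProb
  rw [hbox, bernExp_map]
  refine bernExp_mono h0 h1 fun A _ => ind_mono ?_
  rintro ⟨w, hw, z, hz, hwz⟩
  refine ⟨w - y, hcl A w hw, z - y, ?_, hadj w z hwz⟩
  rw [← hbox, Finset.mem_coe]
  rw [Finset.mem_coe] at hz
  intro h
  refine hz ?_
  rw [mem_latticeBox] at h ⊢
  simpa using h

theorem escapeProb_le_pow {p : ℝ} (h0 : 0 ≤ p) (h1 : p ≤ 1) {S : Finset (Fin d → ℤ)}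
    {L : ℕ} (hS : (0 : Fin d → ℤ) ∈ S) (hSL : S ⊆ latticeBox 0 L) (n : ℕ) :
    escapeProb (latticeL d) (latticeBox 0 n) p 0 ≤
      exitExp (latticeL d) S p 0 ^ (n / (L + 1)) := by
  induction n using Nat.strong_induction_on with
  | _ n ih =>
    rcases lt_or_ge n (L + 1) with hn | hn
    · rw [Nat.div_eq_of_lt hn, pow_zero]
      exact escapeProb_le_one _ h0 h1 _
    · obtain ⟨m, rfl⟩ := Nat.exists_eq_add_of_le' hn
      rw [Nat.add_div_right _ (Nat.succ_pos _), pow_succ']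
      refine le_trans (escapeProb_le_exitExp_mul (S := S)
        (c := escapeProb (latticeL d) (latticeBox 0 m) p 0) ?_ ?_ hS h0 h1 ?_)
        (mul_le_mul_of_nonneg_left (ih m (by omega)) (exitExp_nonneg _ h0 h1 _))
      · exact hSL.trans (latticeBox_subset (self_mem_latticeBox _ 0) (by omega))
      · intro x hx z hxz
        exact latticeBox_subset (self_mem_latticeBox _ 0) (by omega)
          (mem_latticeBox_succ_of_adj (hSL hx) hxz)
      · rintro y - ⟨x, hx, hxy⟩
        exact (escapeProb_le_of_subset (latticeBox_subset
          (mem_latticeBox_succ_of_adj (hSL hx) hxy) le_rfl) h0 h1 (self_mem_latticeBox _ _)).trans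
          (escapeProb_latticeBox_le h0 h1 y m)

theorem openCluster_eq (S : Set (Fin d → ℤ)) (x : Fin d → ℤ) :
    openCluster S x = cluster (latticeL d) S x := by
  ext y
  constructor
  · rintro ⟨hx, hy, h⟩
    obtain ⟨w⟩ := h
    suffices H : ∀ (a b : S) (w : ((latticeL d).induce S).Walk a b),
        (b : Fin d → ℤ) ∈ cluster (latticeL d) S a from H _ _ w
    intro a b w
    induction w with
    | nil => exact mem_cluster_self (Subtype.coe_prop _)
    | cons h w ih =>
      exact cluster_trans (cluster_step (mem_cluster_self (Subtype.coe_prop _)) h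
        (Subtype.coe_prop _)) ih
  · intro hy
    have hx := hy.1
    refine cluster_induction (P := fun y => ∃ (hx : x ∈ S) (hy : y ∈ S),
      ((latticeL d).induce S).Reachable ⟨x, hx⟩ ⟨y, hy⟩) (fun hx => ⟨hx, hx, .rfl⟩) ?_ hy
    rintro a - ⟨hx, ha, h⟩ b hb hab
    exact ⟨hx, hb, h.trans (SimpleGraph.Adj.reachable (by simpa using hab))⟩

theorem setBernoulli_inter_eq {α : Type*} [DecidableEq α] (p : unitInterval)
    (V A : Finset α) (hA : A ⊆ V) :
    setBernoulli (Set.univ : Set α) p {S | S ∩ V = A} =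
      ENNReal.ofReal ((p : ℝ) ^ A.card * (1 - p) ^ (V \ A).card) := by
  rw [setBernoulli_apply']
  have h1 : (fun q : α → Prop => {i | q i}) ⁻¹' {S : Set α | S ∩ V = A} =
      Set.pi (V : Set α) fun i => {q : Prop | q ↔ i ∈ A} := by
    ext q
    simp only [Set.mem_preimage, Set.mem_ofPred_eq, Set.ext_iff, Set.mem_inter_iff,
      Finset.mem_coe, Set.mem_pi]
    constructor
    · intro h i hi
      rw [← h i]; simp [hi]
    · intro h i
      constructor
      · rintro ⟨h1, h2⟩; exact (h i h2).1 h1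
      · intro hi; exact ⟨(h i (hA hi)).2 hi, hA hi⟩
  rw [h1, Measure.infinitePi_pi _ (fun _ _ => MeasurableSet.of_discrete)]
  have h2 : ∀ i ∈ V, ((unitInterval.toNNReal p • Measure.dirac (i ∈ (Set.univ : Set α)) +
      unitInterval.toNNReal (unitInterval.symm p) • Measure.dirac False) : Measure Prop)
        {q : Prop | q ↔ i ∈ A} =
      if i ∈ A then ENNReal.ofReal p else ENNReal.ofReal (1 - p) := by
    intro i _
    split_ifs with hi
    · simp [hi, ENNReal.ofReal, Real.toNNReal_of_nonneg p.2.1]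
      rfl
    · simp [hi]
      rw [ENNReal.ofReal, Real.toNNReal_of_nonneg (sub_nonneg.2 p.2.2)]
      rfl
  rw [Finset.prod_congr rfl h2, Finset.prod_ite, Finset.prod_const, Finset.prod_const,
    ENNReal.ofReal_mul (pow_nonneg p.2.1 _), ENNReal.ofReal_pow p.2.1,
    ENNReal.ofReal_pow (sub_nonneg.2 p.2.2)]
  congr 3
  · ext x; simp only [Finset.mem_filter]
    exact ⟨fun h => h.2, fun h => ⟨hA h, h⟩⟩
  · ext x; simp

theorem measurableSet_inter_eq {α : Type*} (V A : Finset α) :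
    MeasurableSet {S : Set α | S ∩ V = A} := by
  have : {S : Set α | S ∩ V = A} =
      (⋂ i ∈ V, {S : Set α | i ∈ S ↔ i ∈ A}) ∩ {_S : Set α | A ⊆ V} := by
    ext S
    simp only [Set.mem_inter_iff, Set.mem_iInter, Set.mem_ofPred_eq]
    constructor
    · intro h
      refine ⟨fun i hi => ?_, fun i hi => ?_⟩
      · have := Set.ext_iff.1 h i
        simp only [Set.mem_inter_iff, Finset.mem_coe, hi, and_true] at this
        exact this
      · have := (Set.ext_iff.1 h i).2 hi
        exact this.2
    · rintro ⟨h, hAV⟩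
      ext i
      simp only [Set.mem_inter_iff, Finset.mem_coe]
      constructor
      · rintro ⟨h1, h2⟩; exact (h i h2).1 h1
      · intro hi; exact ⟨(h i (hAV hi)).2 hi, hAV hi⟩
  rw [this]
  refine (Finset.measurableSet_biInter _ fun i _ => ?_).inter (MeasurableSet.const _)
  exact measurableSet_setOfPred.2 ((measurable_set_mem i).iff measurable_const)

theorem setBernoulli_ind {α : Type*} [DecidableEq α] (p : unitInterval) (V : Finset α)
    (P : Set α → Prop) :
    MeasurableSet {S : Set α | P (S ∩ V)} ∧
    setBernoulli (Set.univ : Set α) p {S | P (S ∩ V)} =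
      ENNReal.ofReal (bernExp V p (ind fun A => P A)) := by
  classical
  have h1 : {S : Set α | P (S ∩ V)} =
      ⋃ A ∈ V.powerset.filter (fun A : Finset α => P A), {S : Set α | S ∩ V = A} := by
    ext S
    simp only [Set.mem_ofPred_eq, Set.mem_iUnion, Finset.mem_filter, Finset.mem_powerset,
      exists_prop]
    constructor
    · intro h
      have : ((V.filter (· ∈ S) : Finset α) : Set α) = S ∩ V := by
        ext x; simp [and_comm]
      exact ⟨V.filter (· ∈ S), ⟨Finset.filter_subset _ _, this ▸ h⟩, this.symm⟩
    · rintro ⟨A, ⟨-, hA⟩, h⟩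
      rwa [h]
  refine ⟨h1 ▸ Finset.measurableSet_biUnion _ fun A _ => measurableSet_inter_eq V A, ?_⟩
  rw [h1, measure_biUnion_finset ?_ fun A _ => measurableSet_inter_eq V A, bernExp,
    ENNReal.ofReal_sum_of_nonneg, Finset.sum_filter]
  · refine Finset.sum_congr rfl fun A hA => ?_
    split_ifs with h
    · rw [setBernoulli_inter_eq p V A (Finset.mem_powerset.1 hA),
        ind_of (P := fun A : Finset α => P A) h, mul_one]
    · rw [ind_of_not (P := fun A : Finset α => P A) h, mul_zero, ENNReal.ofReal_zero]
  · intro A _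
    exact mul_nonneg (mul_nonneg (pow_nonneg p.2.1 _) (pow_nonneg (sub_nonneg.2 p.2.2) _))
      (ind_nonneg _ _)
  · intro A _ B _ hAB
    refine Set.disjoint_left.2 fun S hA hB => hAB ?_
    have : (A : Set α) = B := Eq.trans (Eq.symm hA) hB
    exact_mod_cast this

theorem le_sitePercolationProb {p : unitInterval} {c : ℝ}
    (hc : ∀ n, c ≤ escapeProb (latticeL d) (latticeBox 0 n) p 0) :
    ENNReal.ofReal c ≤ sitePercolationProb d p := by
  let E : ℕ → Set (Set (Fin d → ℤ)) := fun n =>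
    {S | Escapes (latticeL d) (latticeBox (0 : Fin d → ℤ) n) (S ∩ latticeBox (0 : Fin d → ℤ) n) 0}
  have hE : Antitone E := by
    refine antitone_nat_of_succ_le fun n S hS => ?_
    have hsub : latticeBox (0 : Fin d → ℤ) n ⊆ latticeBox 0 (n + 1) :=
      latticeBox_subset (self_mem_latticeBox _ 0) (by omega)
    have := Escapes.anti (V := latticeBox (0 : Fin d → ℤ) n)
      (by exact_mod_cast hsub) (by exact_mod_cast self_mem_latticeBox _ _) hS
    exact this.mono (Set.inter_subset_inter_left _ Set.inter_subset_left)
  have hinf : (⋂ n, E n) ⊆ {S | (openCluster S 0).Infinite} := by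
    intro S hS hfin
    rw [openCluster_eq] at hfin
    obtain ⟨r, hr⟩ := exists_subset_latticeBox hfin.toFinset 0
    obtain ⟨w, hw, z, hz, hwz⟩ := Set.mem_iInter.1 hS (r + 1)
    refine hz (mem_latticeBox_succ_of_adj (hr ?_) hwz)
    rw [Set.Finite.mem_toFinset]
    exact cluster_mono Set.inter_subset_left 0 hw
  have hmeas := fun n => setBernoulli_ind p (latticeBox (0 : Fin d → ℤ) n)
    (fun A => Escapes (latticeL d) (latticeBox (0 : Fin d → ℤ) n) A 0)
  refine le_trans ?_ (measure_mono hinf)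
  rw [hE.measure_iInter (fun n => (hmeas n).1.nullMeasurableSet) ⟨0, measure_ne_top _ _⟩]
  refine le_iInf fun n => ?_
  rw [(hmeas n).2]
  exact ENNReal.ofReal_le_ofReal (hc n)

theorem siteCritical_le {p : ℝ} (hp : p ∈ unitInterval)
    (h : 0 < sitePercolationProb d ⟨p, hp⟩) : siteCritical d ≤ p :=
  csInf_le ⟨0, fun _ hx => hx.1.1⟩ ⟨hp, h⟩

theorem siteCritical_le_one (d : ℕ) : siteCritical d ≤ 1 := by
  unfold siteCritical
  rcases Set.eq_empty_or_nonempty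
    {p : ℝ | ∃ hp : p ∈ unitInterval, 0 < sitePercolationProb d ⟨p, hp⟩} with h | ⟨p, hp⟩
  · rw [h, Real.sInf_empty]; exact zero_le_one
  · exact (csInf_le ⟨0, fun _ hx => hx.1.1⟩ hp).trans hp.1.2

/-- Sharpness of the phase transition: below the critical point, escape probabilities decay
exponentially. -/
theorem exists_exponential_decay {p : ℝ} (h0 : 0 ≤ p) (hp : p < siteCritical d) :
    ∃ q : ℝ, p < q ∧ q < 1 ∧ ∃ φ : ℝ, 0 ≤ φ ∧ φ < 1 ∧ ∃ L : ℕ, ∀ n,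
      escapeProb (latticeL d) (latticeBox 0 n) q 0 ≤ φ ^ (n / (L + 1)) := by
  obtain ⟨p', hpp', hp'⟩ := exists_between hp
  have hp'1 : p' < 1 := hp'.trans_le (siteCritical_le_one d)
  have : ∃ q ∈ Set.Ioo p p', ∃ S : Finset (Fin d → ℤ), 0 ∈ S ∧
      exitExp (latticeL d) S q 0 < 1 := by
    by_contra! hcon
    have hI : p' ∈ unitInterval := ⟨by linarith, hp'1.le⟩
    have h1 : 0 < sitePercolationProb d ⟨p', hI⟩ := by
      refine lt_of_lt_of_le (ENNReal.ofReal_pos.2 ?_) (le_sitePercolationProb (p := ⟨p', hI⟩)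
        fun n => le_escapeProb (self_mem_latticeBox 0 n) h0 hpp' hp'1 hcon)
      exact div_pos (by linarith) (by linarith)
    exact absurd (siteCritical_le hI h1) (not_le.2 hp')
  obtain ⟨q, hq, S, hS, hφ⟩ := this
  obtain ⟨L, hL⟩ := exists_subset_latticeBox S 0
  have hq0 : 0 ≤ q := h0.trans hq.1.le
  have hq1 : q < 1 := hq.2.trans hp'1
  exact ⟨q, hq.1, hq1, _, exitExp_nonneg S hq0 hq1.le 0, hφ, L,
    fun n => escapeProb_le_pow hq0 hq1.le hS hL n⟩

end Lattice

section Coordinates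

variable {N d : ℕ} [NeZero N]

theorem intCast_pos_of_neZero : (0 : ℤ) < N := by exact_mod_cast NeZero.pos N

/-- The cell of side length `M` containing the lattice point `x`. -/
def cellDiv (M : ℕ) (x : Fin d → ℤ) : Fin d → ℤ := fun j => x j / M

/-- The position of `x` within its cell of side length `N`. -/
def digit (N : ℕ) [NeZero N] (x : Fin d → ℤ) : SubcubeIndex N d := fun j =>
  ⟨(x j % N).toNat, by
    have := Int.emod_lt_of_pos (x j) (intCast_pos_of_neZero (N := N))
    have := Int.emod_nonneg (x j) (intCast_pos_of_neZero (N := N)).ne'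
    omega⟩

/-- The lattice point at position `i` within the cell `c` of side length `N`. -/
def joinCell (c : Fin d → ℤ) (i : SubcubeIndex N d) : Fin d → ℤ := fun j => N * c j + (i j : ℕ)

theorem digit_apply (x : Fin d → ℤ) (j : Fin d) : ((digit N x j : ℕ) : ℤ) = x j % N :=
  Int.toNat_of_nonneg (Int.emod_nonneg _ (intCast_pos_of_neZero (N := N)).ne')

theorem joinCell_cellDiv_digit (x : Fin d → ℤ) : joinCell (cellDiv N x) (digit N x) = x := by
  funext j
  simp only [joinCell, cellDiv, digit_apply]
  exact Int.mul_ediv_add_emod _ _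

theorem cellDiv_joinCell (c : Fin d → ℤ) (i : SubcubeIndex N d) :
    cellDiv N (joinCell c i) = c := by
  funext j
  have hN : (0 : ℤ) < N := intCast_pos_of_neZero
  simp only [joinCell, cellDiv]
  rw [Int.mul_add_ediv_left _ _ hN.ne', Int.ediv_eq_zero_of_lt (by positivity) (by simp), add_zero]

theorem digit_joinCell (c : Fin d → ℤ) (i : SubcubeIndex N d) : digit N (joinCell c i) = i := by
  funext j
  have h : ((digit N (joinCell c i) j : ℕ) : ℤ) = (i j : ℕ) := by
    rw [digit_apply]
    simp only [joinCell]
    rw [Int.mul_add_emod_self_left, Int.emod_eq_of_lt (by positivity) (by simp)]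
  exact Fin.ext (by exact_mod_cast h)

omit [NeZero N] in
theorem cellDiv_cellDiv_pow (n : ℕ) (x : Fin d → ℤ) :
    cellDiv (N ^ n) (cellDiv N x) = cellDiv (N ^ (n + 1)) x := by
  funext j
  simp only [cellDiv]
  rw [Int.ediv_ediv_of_nonneg (by positivity), pow_succ']
  push_cast
  rfl

omit [NeZero N] in
theorem cellDiv_pow_cellDiv (n : ℕ) (x : Fin d → ℤ) :
    cellDiv N (cellDiv (N ^ n) x) = cellDiv (N ^ (n + 1)) x := by
  funext j
  simp only [cellDiv]
  rw [Int.ediv_ediv_of_nonneg (by positivity), pow_succ]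
  push_cast
  rfl

theorem abs_ediv_sub_ediv_le {M : ℕ} (hM : 0 < M) {a b : ℤ} (h : |a - b| ≤ 1) :
    |a / (M : ℤ) - b / (M : ℤ)| ≤ 1 := by
  have hM' : (0 : ℤ) < M := by exact_mod_cast hM
  have key : ∀ a b : ℤ, a ≤ b + 1 → a / (M : ℤ) ≤ b / (M : ℤ) + 1 := by
    intro a b hab
    rw [← Int.add_mul_ediv_right _ _ hM'.ne']
    exact Int.ediv_le_ediv hM' (by linarith)
  rw [abs_le] at *
  have h1 := key a b (by linarith)
  have h2 := key b a (by linarith)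
  constructor <;> linarith

/-- The address of the level-`m` cube at the lattice point `y`, taken modulo `N ^ m`. -/
def addr (N : ℕ) [NeZero N] : ℕ → (Fin d → ℤ) → List (SubcubeIndex N d)
  | 0, _ => []
  | m + 1, y => addr N m (cellDiv N y) ++ [digit N y]

theorem length_addr (m : ℕ) (y : Fin d → ℤ) : (addr N m y).length = m := by
  induction m generalizing y with
  | zero => rfl
  | succ m ih => simp [addr, ih]

theorem dvd_sub_of_addr_eq {m : ℕ} {y y' : Fin d → ℤ} (h : addr N m y = addr N m y')
    (j : Fin d) : (N : ℤ) ^ m ∣ y j - y' j := by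
  induction m generalizing y y' with
  | zero => simp
  | succ m ih =>
    simp only [addr] at h
    obtain ⟨h1, h2⟩ := List.append_inj h (by simp [length_addr])
    have h3 := ih h1
    simp only [List.cons.injEq, and_true] at h2
    rw [← joinCell_cellDiv_digit (N := N) y, ← joinCell_cellDiv_digit (N := N) y', h2]
    simp only [joinCell]
    rw [add_sub_add_right_eq_sub, ← mul_sub, pow_succ']
    exact mul_dvd_mul_left _ h3

theorem take_addr (m n : ℕ) (x : Fin d → ℤ) :
    (addr N (m + n) x).take m = addr N m (cellDiv (N ^ n) x) := by
  induction n generalizing x with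
  | zero =>
    have : cellDiv (N ^ 0) x = x := by funext j; simp [cellDiv]
    rw [this, List.take_of_length_le (by simp [length_addr])]
    rfl
  | succ n ih =>
    rw [← add_assoc, addr, List.take_append_of_le_length (by simp [length_addr]), ih,
      cellDiv_cellDiv_pow]

/-- The level-`(m + n)` cube at `x` is selected, and so are its ancestors of levels greater
than `m`. -/
def RetainedFrom (ω : Configuration N d) (m : ℕ) : ℕ → (Fin d → ℤ) → Prop
  | 0, _ => True
  | n + 1, x => digit N x ∈ ω (addr N (m + n) (cellDiv N x)) ∧ RetainedFrom ω m n (cellDiv N x)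

theorem RetainedFrom.succ_left {ω : Configuration N d} {m n : ℕ} {x : Fin d → ℤ}
    (h : RetainedFrom ω m (n + 1) x) : RetainedFrom ω (m + 1) n x := by
  induction n generalizing x with
  | zero => trivial
  | succ n ih =>
    refine ⟨?_, ih h.2⟩
    have := h.1
    rwa [show m + (n + 1) = m + 1 + n by omega] at this

theorem RetainedFrom.congr {ω ω' : Configuration N d} {m n : ℕ} {x : Fin d → ℤ}
    (hω : ∀ I : List (SubcubeIndex N d), m ≤ I.length → I.length < m + n →
      I.take m = addr N m (cellDiv (N ^ n) x) → ω I = ω' I)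
    (h : RetainedFrom ω m n x) : RetainedFrom ω' m n x := by
  induction n generalizing x with
  | zero => trivial
  | succ n ih =>
    refine ⟨?_, ih (fun I h1 h2 h3 => hω I h1 (by omega) ?_) h.2⟩
    · rw [← hω _ (by simp [length_addr]) (by simp [length_addr])]
      · exact h.1
      · rw [take_addr, cellDiv_cellDiv_pow]
    · rw [h3, cellDiv_cellDiv_pow]

theorem IsRetained.retainedFrom {ω : Configuration N d} {n : ℕ} {x : Fin d → ℤ}
    (h : IsRetained ω (addr N n x)) : RetainedFrom ω 0 n x := by
  induction n generalizing x with
  | zero => trivial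
  | succ n ih =>
    refine ⟨h _ _ ?_, ih fun J i hJ => h J i ?_⟩
    · rw [zero_add]; exact List.prefix_rfl
    · exact hJ.trans (List.prefix_append _ _)

/-- A path of level-`(m + n)` cubes, all of them retained from level `m` on, leads from the level-`m`
cube at `y` to a level-`m` cube at distance two, through cubes at distance at most two. -/
def Reaches (ω : Configuration N d) (m n : ℕ) (y : Fin d → ℤ) : Prop :=
  ∃ x₀ x₁, x₁ ∈ cluster (latticeL d)
      ({x | RetainedFrom ω m n x} ∩ {x | cellDiv (N ^ n) x ∈ latticeBox y 2}) x₀ ∧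
    cellDiv (N ^ n) x₀ = y ∧ ∃ i, 2 ≤ |cellDiv (N ^ n) x₁ i - y i|

theorem reaches_of_mem_cluster {ω : Configuration N d} {m n : ℕ} {x₀ x₁ : Fin d → ℤ}
    (h : x₁ ∈ cluster (latticeL d) {x | RetainedFrom ω m n x} x₀)
    (hi : ∃ i, 2 ≤ |cellDiv (N ^ n) x₁ i - cellDiv (N ^ n) x₀ i|) :
    Reaches ω m n (cellDiv (N ^ n) x₀) := by
  have hpos : 0 < N ^ n := pow_pos (NeZero.pos N) n
  rcases cluster_inter_or_exit (V := {x | cellDiv (N ^ n) x ∈ latticeBox (cellDiv (N ^ n) x₀) 2})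
    (self_mem_latticeBox _ _) h with h | ⟨w, hw, z, hz, hwz⟩
  · exact ⟨x₀, x₁, h, rfl, hi⟩
  · refine ⟨x₀, w, hw, rfl, ?_⟩
    have hz2 : ¬ cellDiv (N ^ n) z ∈ latticeBox (cellDiv (N ^ n) x₀) 2 := hz.2
    rw [mem_latticeBox] at hz2
    push Not at hz2
    obtain ⟨i, hi⟩ := hz2
    refine ⟨i, ?_⟩
    have h1 := abs_ediv_sub_ediv_le hpos (hwz.2.1 i)
    have h2 := abs_sub_le (cellDiv (N ^ n) z i) (cellDiv (N ^ n) w i) (cellDiv (N ^ n) x₀ i)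
    have h3 : |cellDiv (N ^ n) z i - cellDiv (N ^ n) w i| ≤ 1 := by
      rw [abs_sub_comm]; exact h1
    push_cast at hi
    omega

theorem le_abs_sub_of_two_le {a b : ℤ} (h : 2 ≤ |b / (N : ℤ) - a / (N : ℤ)|) :
    (N : ℤ) + 1 ≤ |b - a| := by
  have hN : (0 : ℤ) < N := intCast_pos_of_neZero
  have key : ∀ a b : ℤ, 2 ≤ b / (N : ℤ) - a / (N : ℤ) → (N : ℤ) + 1 ≤ b - a := by
    intro a b h
    have h1 := Int.mul_ediv_add_emod a N
    have h2 := Int.mul_ediv_add_emod b N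
    have h3 := Int.emod_lt_of_pos a hN
    have h4 := Int.emod_nonneg b hN.ne'
    nlinarith
  rcases le_abs.1 h with h | h
  · exact le_abs.2 (.inl (key a b h))
  · exact le_abs.2 (.inr (by have := key b a (by linarith); linarith))

theorem Reaches.exists_pair {ω : Configuration N d} {m n : ℕ} {y : Fin d → ℤ}
    (h : Reaches ω m (n + 1) y) :
    ∃ Q Q' : Fin d → ℤ, cellDiv N Q ∈ latticeBox y 2 ∧ cellDiv N Q' ∈ latticeBox y 2 ∧
      (∃ i, (N : ℤ) + 1 ≤ |Q' i - Q i|) ∧ Reaches ω (m + 1) n Q ∧ Reaches ω (m + 1) n Q' := by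
  obtain ⟨x₀, x₁, hx, h0, i, hi⟩ := h
  have hN : (0 : ℤ) < N := intCast_pos_of_neZero
  have hcl : x₁ ∈ cluster (latticeL d) {x | RetainedFrom ω (m + 1) n x} x₀ :=
    cluster_mono (fun x hx => hx.1.succ_left) _ hx
  have hd : (N : ℤ) + 1 ≤ |cellDiv (N ^ n) x₁ i - cellDiv (N ^ n) x₀ i| := by
    refine le_abs_sub_of_two_le ?_
    rw [← h0, ← cellDiv_pow_cellDiv, ← cellDiv_pow_cellDiv] at hi
    exact hi
  refine ⟨cellDiv (N ^ n) x₀, cellDiv (N ^ n) x₁, ?_, ?_, ⟨i, hd⟩,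
    reaches_of_mem_cluster hcl ⟨i, by omega⟩,
    reaches_of_mem_cluster (cluster_symm hcl) ⟨i, by rw [abs_sub_comm]; omega⟩⟩
  · rw [cellDiv_pow_cellDiv, h0]
    exact self_mem_latticeBox _ _
  · rw [cellDiv_pow_cellDiv]
    exact (cluster_subset _ _ hx).2

/-- The addresses of the cubes whose selections determine `Reaches ω m n y`. -/
def reachSupport (N : ℕ) [NeZero N] (m n : ℕ) (y : Fin d → ℤ) : Set (List (SubcubeIndex N d)) :=
  {I | I.length < m + n ∧ ∃ c ∈ latticeBox y 2, I.take m = addr N m c}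

theorem finite_reachSupport (m n : ℕ) (y : Fin d → ℤ) : (reachSupport N m n y).Finite :=
  (List.finite_length_lt _ (m + n)).subset fun _ h => h.1

theorem Reaches.congr {ω ω' : Configuration N d} {m n : ℕ} {y : Fin d → ℤ}
    (hω : ∀ I ∈ reachSupport N m n y, ω I = ω' I) (h : Reaches ω m n y) : Reaches ω' m n y := by
  obtain ⟨x₀, x₁, hx, h⟩ := h
  refine ⟨x₀, x₁, cluster_mono ?_ _ hx, h⟩
  rintro x ⟨h1, h2⟩
  exact ⟨h1.congr fun I _ h4 h5 => hω I ⟨h4, _, h2, h5⟩, h2⟩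

theorem disjoint_reachSupport {m n : ℕ} {y y' : Fin d → ℤ} {i : Fin d} (h5 : 5 ≤ |y' i - y i|)
    (hm : |y' i - y i| + 5 ≤ (N : ℤ) ^ m) :
    Disjoint (reachSupport N m n y) (reachSupport N m n y') := by
  rw [Set.disjoint_left]
  rintro I ⟨-, c, hc, hIc⟩ ⟨-, c', hc', hIc'⟩
  have hdvd := dvd_sub_of_addr_eq (hIc'.symm.trans hIc) i
  have h1 := mem_latticeBox.1 hc i
  have h2 := mem_latticeBox.1 hc' i
  push_cast at h1 h2
  have h3 : c' i - c i = 0 := by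
    refine Int.eq_zero_of_abs_lt_dvd hdvd ?_
    rw [abs_lt]
    rw [abs_le] at h1 h2
    have := le_abs_self (y' i - y i)
    have := neg_abs_le (y' i - y i)
    constructor <;> linarith
  rw [abs_le] at h1 h2
  rcases le_abs.1 h5 with h | h <;> linarith

end Coordinates

section Independence

variable {N d k : ℕ}

theorem isProbabilityMeasure_uniformOn_card (hk : k ≤ N ^ d) :
    IsProbabilityMeasure (uniformOn {A : Finset (SubcubeIndex N d) | A.card = k}) := by
  refine isProbabilityMeasure_uniformOn (Set.toFinite _) ?_
  obtain ⟨A, -, hA⟩ := Finset.exists_subset_card_eq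
    (s := (Finset.univ : Finset (SubcubeIndex N d))) (n := k) (by simpa using hk)
  exact ⟨A, hA⟩

/-- Events that are determined by the selections of disjoint finite sets of cubes are
independent. -/
theorem kModelMeasure_inter (hk : k ≤ N ^ d) {E E' : Set (Configuration N d)}
    {T T' : Set (List (SubcubeIndex N d))} (hT : T.Finite) (hT' : T'.Finite)
    (hTT : Disjoint T T')
    (hE : ∀ ω ω', (∀ I ∈ T, ω I = ω' I) → ω ∈ E → ω' ∈ E)
    (hE' : ∀ ω ω', (∀ I ∈ T', ω I = ω' I) → ω ∈ E' → ω' ∈ E') :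
    kModelMeasure k N d (E ∩ E') = kModelMeasure k N d E * kModelMeasure k N d E' := by
  classical
  have := isProbabilityMeasure_uniformOn_card hk
  lift T to Finset (List (SubcubeIndex N d)) using hT
  lift T' to Finset (List (SubcubeIndex N d)) using hT'
  have hind : iIndepFun (fun (I : List (SubcubeIndex N d)) (ω : Configuration N d) => ω I)
      (kModelMeasure k N d) :=
    iIndepFun_infinitePi (X := fun _ => id) fun _ => measurable_id
  have h2 := hind.indepFun_finset T T' (by exact_mod_cast hTT) fun I => measurable_pi_apply I
  have key : ∀ (T : Finset (List (SubcubeIndex N d))) (E : Set (Configuration N d)),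
      (∀ ω ω', (∀ I ∈ (T : Set (List (SubcubeIndex N d))), ω I = ω' I) → ω ∈ E → ω' ∈ E) →
      (fun (ω : Configuration N d) (I : T) => ω I) ⁻¹'
        ((fun (ω : Configuration N d) (I : T) => ω I) '' E) = E := by
    intro T E hE
    refine Set.Subset.antisymm ?_ (Set.subset_preimage_image _ _)
    rintro ω' ⟨ω, hω, h⟩
    exact hE ω ω' (fun I hI => congrFun h ⟨I, hI⟩) hω
  have h3 := h2.measure_inter_preimage_eq_mul _ _
    (Set.toFinite ((fun (ω : Configuration N d) (I : T) => ω I) '' E)).measurableSet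
    (Set.toFinite ((fun (ω : Configuration N d) (I : T') => ω I) '' E')).measurableSet
  rwa [key T E hE, key T' E' hE'] at h3

end Independence

section Recursion

variable {N d k : ℕ} [NeZero N]

/-- The lattice points in the cells of side length `N` at distance at most two from `y`. -/
noncomputable def cellBlock (N : ℕ) (y : Fin d → ℤ) : Finset (Fin d → ℤ) :=
  ((latticeBox y 2) ×ˢ (Finset.univ : Finset (SubcubeIndex N d))).image fun q => joinCell q.1 q.2

theorem mem_cellBlock {y x : Fin d → ℤ} :
    x ∈ cellBlock N y ↔ cellDiv N x ∈ latticeBox y 2 := by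
  simp only [cellBlock, Finset.mem_image, Finset.mem_product, Finset.mem_univ, and_true]
  constructor
  · rintro ⟨q, hq, rfl⟩
    rwa [cellDiv_joinCell]
  · intro h
    exact ⟨(cellDiv N x, digit N x), h, joinCell_cellDiv_digit x⟩

theorem card_latticeBox_two (y : Fin d → ℤ) : (latticeBox y 2).card = 5 ^ d := by
  rw [latticeBox, Pi.card_Icc]
  simp only [Int.card_Icc]
  rw [Finset.prod_congr rfl (g := fun _ => 5) fun i _ => by push_cast; omega]
  simp

omit [NeZero N] in
theorem card_cellBlock_le (y : Fin d → ℤ) : (cellBlock N y).card ≤ (5 * N) ^ d := by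
  refine Finset.card_image_le.trans ?_
  rw [Finset.card_product, card_latticeBox_two, mul_pow]
  simp

theorem abs_sub_le_of_mem_cellBlock {y x x' : Fin d → ℤ} (hx : x ∈ cellBlock N y)
    (hx' : x' ∈ cellBlock N y) (i : Fin d) : |x' i - x i| ≤ 5 * N := by
  have hN : (0 : ℤ) < N := intCast_pos_of_neZero
  have h1 := mem_latticeBox.1 (mem_cellBlock.1 hx) i
  have h2 := mem_latticeBox.1 (mem_cellBlock.1 hx') i
  simp only [cellDiv] at h1 h2
  push_cast at h1 h2
  rw [abs_le] at h1 h2 ⊢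
  have e1 := Int.mul_ediv_add_emod (x i) N
  have e2 := Int.mul_ediv_add_emod (x' i) N
  have := Int.emod_lt_of_pos (x i) hN
  have := Int.emod_nonneg (x i) hN.ne'
  have := Int.emod_lt_of_pos (x' i) hN
  have := Int.emod_nonneg (x' i) hN.ne'
  constructor <;> nlinarith

theorem measure_reaches_succ_le (hk : k ≤ N ^ d) (hN : 6 ≤ N) {m n : ℕ} (hm : 1 ≤ m)
    {ε : ENNReal} (h : ∀ y : Fin d → ℤ, kModelMeasure k N d {ω | Reaches ω (m + 1) n y} ≤ ε)
    (y : Fin d → ℤ) :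
    kModelMeasure k N d {ω | Reaches ω m (n + 1) y} ≤ (((5 * N) ^ d : ℕ) : ENNReal) ^ 2 * ε ^ 2 := by
  let K := ((cellBlock N y) ×ˢ (cellBlock N y)).filter fun q => ∃ i, (N : ℤ) + 1 ≤ |q.2 i - q.1 i|
  have hsub : {ω : Configuration N d | Reaches ω m (n + 1) y} ⊆
      ⋃ q ∈ K, ({ω | Reaches ω (m + 1) n q.1} ∩ {ω | Reaches ω (m + 1) n q.2}) := by
    intro ω hω
    obtain ⟨Q, Q', h1, h2, h3, h4⟩ := Reaches.exists_pair hω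
    refine Set.mem_biUnion (x := (Q, Q')) ?_ h4
    simp only [K, Finset.coe_filter, Finset.mem_product, mem_cellBlock]
    exact ⟨⟨h1, h2⟩, h3⟩
  have hK : K.card ≤ ((5 * N) ^ d) ^ 2 := by
    refine (Finset.card_filter_le _ _).trans ?_
    rw [Finset.card_product, sq]
    exact Nat.mul_le_mul (card_cellBlock_le y) (card_cellBlock_le y)
  have hq : ∀ q ∈ K, kModelMeasure k N d
      ({ω | Reaches ω (m + 1) n q.1} ∩ {ω | Reaches ω (m + 1) n q.2}) ≤ ε ^ 2 := by
    intro q hq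
    simp only [K, Finset.mem_filter, Finset.mem_product] at hq
    obtain ⟨⟨h1, h2⟩, i, hi⟩ := hq
    have h6 : (6 : ℤ) ≤ N := by exact_mod_cast hN
    have h7 := abs_sub_le_of_mem_cellBlock h1 h2 i
    have h8 : (N : ℤ) ^ 2 ≤ (N : ℤ) ^ (m + 1) :=
      pow_le_pow_right₀ (by linarith) (by omega)
    rw [kModelMeasure_inter (E := {ω | Reaches ω (m + 1) n q.1})
      (E' := {ω | Reaches ω (m + 1) n q.2}) hk (finite_reachSupport (m + 1) n q.1)
      (finite_reachSupport (m + 1) n q.2)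
      (disjoint_reachSupport (i := i) (by linarith) (by nlinarith))
      (fun ω ω' h hω => Reaches.congr h hω) (fun ω ω' h hω => Reaches.congr h hω), sq]
    exact mul_le_mul' (h _) (h _)
  calc kModelMeasure k N d {ω | Reaches ω m (n + 1) y}
      ≤ ∑ q ∈ K, kModelMeasure k N d
        ({ω | Reaches ω (m + 1) n q.1} ∩ {ω | Reaches ω (m + 1) n q.2}) :=
        (measure_mono hsub).trans (measure_biUnion_finset_le _ _)
    _ ≤ K.card • ε ^ 2 := Finset.sum_le_card_nsmul _ _ _ hq
    _ ≤ _ := by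
        rw [nsmul_eq_mul]
        refine mul_le_mul_left ?_ _
        exact_mod_cast hK

/-- If the probability to reach distance two in one step is small enough, the probability to do so
in `n` steps tends to zero. -/
theorem measure_reaches_le (hk : k ≤ N ^ d) (hN : 6 ≤ N)
    (h : ∀ m ≥ 1, ∀ y : Fin d → ℤ, kModelMeasure k N d {ω | Reaches ω m 1 y} ≤
      ((((5 * N) ^ d : ℕ) : ENNReal) ^ 2)⁻¹ * 2⁻¹)
    (n : ℕ) : ∀ m ≥ 1, ∀ y : Fin d → ℤ, kModelMeasure k N d {ω | Reaches ω m (n + 1) y} ≤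
      ((((5 * N) ^ d : ℕ) : ENNReal) ^ 2)⁻¹ * 2⁻¹ ^ (n + 1) := by
  induction n with
  | zero => simpa using h
  | succ n ih =>
    intro m hm y
    refine (measure_reaches_succ_le hk hN hm (ih (m + 1) (by omega)) y).trans ?_
    set C : ENNReal := (((5 * N) ^ d : ℕ) : ENNReal) ^ 2 with hC
    have hC0 : C ≠ 0 := by
      rw [hC]
      refine pow_ne_zero _ (Nat.cast_ne_zero.2 (pow_ne_zero _ (by omega)))
    have hCt : C ≠ ⊤ := ENNReal.pow_ne_top (ENNReal.natCast_ne_top _)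
    calc C * (C⁻¹ * 2⁻¹ ^ (n + 1)) ^ 2 = (C * C⁻¹) * (C⁻¹ * 2⁻¹ ^ (2 * (n + 1))) := by
          rw [pow_mul' _ 2 (n + 1)]; ring
      _ = C⁻¹ * 2⁻¹ ^ (2 * (n + 1)) := by rw [ENNReal.mul_inv_cancel hC0 hCt, one_mul]
      _ ≤ C⁻¹ * 2⁻¹ ^ (n + 1 + 1) := by
          refine mul_le_mul_right (pow_le_pow_right_of_le_one' ?_ (by omega)) _
          exact ENNReal.inv_le_one.2 one_le_two

end Recursion

section Comparison

theorem choose_mul_pow_le_succ {M k j : ℕ} (hk : k ≤ M) (hj : j < k) :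
    M.choose j * k ^ j * (M - k) ^ (M - j) ≤
      M.choose (j + 1) * k ^ (j + 1) * (M - k) ^ (M - (j + 1)) := by
  refine Nat.le_of_mul_le_mul_right ?_ (Nat.succ_pos j)
  rw [Nat.succ_eq_add_one]
  have h1 := Nat.choose_succ_right_eq M j
  have h2 : M - j = M - (j + 1) + 1 := by omega
  calc M.choose j * k ^ j * (M - k) ^ (M - j) * (j + 1)
      = M.choose j * k ^ j * (M - k) ^ (M - (j + 1)) * ((j + 1) * (M - k)) := by
        rw [h2, pow_succ]; ring
    _ ≤ M.choose j * k ^ j * (M - k) ^ (M - (j + 1)) * (k * (M - j)) :=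
        Nat.mul_le_mul_left _ (Nat.mul_le_mul hj (by omega))
    _ = M.choose j * (M - j) * k ^ (j + 1) * (M - k) ^ (M - (j + 1)) := by rw [pow_succ]; ring
    _ = _ := by rw [← h1]; ring

theorem choose_mul_pow_succ_le {M k j : ℕ} (hj : k ≤ j) (hjM : j < M) :
    M.choose (j + 1) * k ^ (j + 1) * (M - k) ^ (M - (j + 1)) ≤
      M.choose j * k ^ j * (M - k) ^ (M - j) := by
  refine Nat.le_of_mul_le_mul_right ?_ (Nat.succ_pos j)
  rw [Nat.succ_eq_add_one]
  have h1 := Nat.choose_succ_right_eq M j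
  have h2 : M - j = M - (j + 1) + 1 := by omega
  calc M.choose (j + 1) * k ^ (j + 1) * (M - k) ^ (M - (j + 1)) * (j + 1)
      = M.choose (j + 1) * (j + 1) * k ^ (j + 1) * (M - k) ^ (M - (j + 1)) := by ring
    _ = M.choose j * k ^ j * (M - k) ^ (M - (j + 1)) * (k * (M - j)) := by
        rw [h1, pow_succ]; ring
    _ ≤ M.choose j * k ^ j * (M - k) ^ (M - (j + 1)) * ((j + 1) * (M - k)) :=
        Nat.mul_le_mul_left _ (Nat.mul_le_mul (by omega) (by omega))
    _ = _ := by rw [h2, pow_succ]; ring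

/-- The binomial distribution with mean `k` attains its maximum at `k`. -/
theorem choose_mul_pow_le {M k j : ℕ} (hk : k ≤ M) (hj : j ≤ M) :
    M.choose j * k ^ j * (M - k) ^ (M - j) ≤ M.choose k * k ^ k * (M - k) ^ (M - k) := by
  rcases le_total j k with h | h
  · obtain ⟨i, rfl⟩ := Nat.exists_eq_add_of_le h
    clear h hj
    induction i generalizing j with
    | zero => rfl
    | succ i ih =>
      have h1 := choose_mul_pow_le_succ (j := j) hk (by omega)
      have h2 := ih (j := j + 1) (by omega)
      rw [show j + 1 + i = j + (i + 1) by omega] at h2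
      exact h1.trans h2
  · induction j, h using Nat.le_induction with
    | base => rfl
    | succ j hkj ih =>
      exact (choose_mul_pow_succ_le hkj (by omega)).trans (ih (by omega))

theorem pow_le_succ_mul_choose_mul {M k : ℕ} (hk : k ≤ M) :
    M ^ M ≤ (M + 1) * (M.choose k * k ^ k * (M - k) ^ (M - k)) := by
  calc M ^ M = (k + (M - k)) ^ M := by rw [Nat.add_sub_cancel' hk]
    _ = ∑ j ∈ Finset.range (M + 1), M.choose j * k ^ j * (M - k) ^ (M - j) := by
        rw [add_pow]
        exact Finset.sum_congr rfl fun j _ => by push_cast; ring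
    _ ≤ (Finset.range (M + 1)).card • (M.choose k * k ^ k * (M - k) ^ (M - k)) :=
        Finset.sum_le_card_nsmul _ _ _ fun j hj =>
          choose_mul_pow_le hk (by simpa [Nat.lt_succ_iff] using hj)
    _ = _ := by simp

theorem inv_choose_le {M k : ℕ} (hM : 0 < M) (hk : k ≤ M) :
    ((M.choose k : ℝ))⁻¹ ≤
      (M + 1) * (((k : ℝ) / M) ^ k * (1 - (k : ℝ) / M) ^ (M - k)) := by
  have hM' : (0 : ℝ) < M := by exact_mod_cast hM
  have hc : (0 : ℝ) < M.choose k := by exact_mod_cast Nat.choose_pos hk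
  have h1 : (M : ℝ) ^ M ≤ (M + 1) * (M.choose k * k ^ k * ((M : ℝ) - k) ^ (M - k)) := by
    have := pow_le_succ_mul_choose_mul hk
    rw [← Nat.cast_sub hk]
    exact_mod_cast this
  have h2 : (1 - (k : ℝ) / M) = ((M : ℝ) - k) / M := by field_simp
  have h3 : (M : ℝ) ^ k * (M : ℝ) ^ (M - k) = (M : ℝ) ^ M := by
    rw [← pow_add, Nat.add_sub_cancel' hk]
  rw [h2, div_pow, div_pow, div_mul_div_comm, h3, inv_le_iff_one_le_mul₀ hc, mul_div_assoc',
    div_mul_eq_mul_div, one_le_div (by positivity)]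
  linarith

variable {N d k : ℕ} [NeZero N]

theorem uniformOn_card_singleton_le (hk : k ≤ N ^ d) (X : Finset (SubcubeIndex N d)) :
    uniformOn {A : Finset (SubcubeIndex N d) | A.card = k} {X} ≤
      ENNReal.ofReal (((N : ℝ) ^ d + 1) * (((k : ℝ) / (N : ℝ) ^ d) ^ X.card *
        (1 - (k : ℝ) / (N : ℝ) ^ d) ^ (Finset.univ \ X).card)) := by
  have hcard : Fintype.card (SubcubeIndex N d) = N ^ d := by simp
  have hs : {A : Finset (SubcubeIndex N d) | A.card = k} =
      ((Finset.univ : Finset (SubcubeIndex N d)).powersetCard k : Set _) := by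
    ext A; simp [Finset.mem_powersetCard]
  have hX : ({X} : Set (Finset (SubcubeIndex N d))) = (({X} : Finset _) : Set _) := by simp
  rw [hs, hX, uniformOn_apply_finset]
  by_cases hXk : X.card = k
  · have h1 : Finset.powersetCard k (Finset.univ : Finset (SubcubeIndex N d)) ∩ {X} = {X} := by
      ext A; simp only [Finset.mem_inter, Finset.mem_powersetCard, Finset.mem_singleton]
      constructor
      · exact fun h => h.2
      · rintro rfl; exact ⟨⟨Finset.subset_univ _, hXk⟩, rfl⟩
    have hpos : 0 < (N ^ d).choose k := Nat.choose_pos hk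
    have h2 := inv_choose_le (pow_pos (NeZero.pos N) d) hk
    push_cast at h2
    rw [h1, Finset.card_singleton, Finset.card_powersetCard, Finset.card_univ, hcard,
      Finset.card_sdiff_of_subset (Finset.subset_univ _), Finset.card_univ, hcard, hXk]
    refine le_trans (le_of_eq ?_) (ENNReal.ofReal_le_ofReal h2)
    rw [ENNReal.ofReal_inv_of_pos (by exact_mod_cast hpos), ENNReal.ofReal_natCast]
    simp
  · have h1 : Finset.powersetCard k (Finset.univ : Finset (SubcubeIndex N d)) ∩ {X} = ∅ := by
      ext A; simp only [Finset.mem_inter, Finset.mem_powersetCard, Finset.mem_singleton]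
      constructor
      · rintro ⟨⟨-, h⟩, rfl⟩; exact absurd h hXk
      · simp
    rw [h1]
    simp

open Classical in
/-- The lattice points near the cell `y` whose level-`(m + 1)` cubes are selected. -/
noncomputable def selectedIn (ω : Configuration N d) (m : ℕ) (y : Fin d → ℤ) :
    Finset (Fin d → ℤ) :=
  (cellBlock N y).filter fun x => digit N x ∈ ω (addr N m (cellDiv N x))

theorem card_eq_sum_fiber {y : Fin d → ℤ} {A : Finset (Fin d → ℤ)} (hA : A ⊆ cellBlock N y) :
    A.card = ∑ c ∈ latticeBox y 2,
      (Finset.univ.filter fun i : SubcubeIndex N d => joinCell c i ∈ A).card := by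
  rw [Finset.card_eq_sum_card_fiberwise (f := cellDiv N) (t := latticeBox y 2)
    fun x hx => mem_cellBlock.1 (hA hx)]
  refine Finset.sum_congr rfl fun c _ => ?_
  refine Finset.card_bij' (fun x _ => digit N x) (fun i _ => joinCell c i) ?_ ?_ ?_ ?_
  · intro x hx
    simp only [Finset.mem_filter, Finset.mem_univ, true_and] at hx ⊢
    rw [← hx.2, joinCell_cellDiv_digit]
    exact hx.1
  · intro i hi
    simp only [Finset.mem_filter, Finset.mem_univ, true_and] at hi ⊢
    exact ⟨hi, cellDiv_joinCell c i⟩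
  · intro x hx
    simp only [Finset.mem_filter] at hx
    rw [← hx.2, joinCell_cellDiv_digit]
  · intro i _
    exact digit_joinCell c i

theorem addr_injOn {m : ℕ} (hm : 1 ≤ m) (hN : 6 ≤ N) (y : Fin d → ℤ) :
    Set.InjOn (addr N m) (latticeBox y 2 : Set (Fin d → ℤ)) := by
  intro c hc c' hc' h
  funext i
  have h1 := mem_latticeBox.1 hc i
  have h2 := mem_latticeBox.1 hc' i
  have h6 : (6 : ℤ) ≤ (N : ℤ) ^ m :=
    le_trans (by exact_mod_cast hN) (le_self_pow₀ (by exact_mod_cast NeZero.one_le) (by omega))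
  push_cast at h1 h2
  refine sub_eq_zero.1 (Int.eq_zero_of_abs_lt_dvd (dvd_sub_of_addr_eq h i) ?_)
  rw [abs_lt]
  rw [abs_le] at h1 h2
  constructor <;> linarith

theorem measure_selectedIn_eq_le (hk : k ≤ N ^ d) (hN : 6 ≤ N) {m : ℕ} (hm : 1 ≤ m)
    (y : Fin d → ℤ) {A : Finset (Fin d → ℤ)} (hA : A ⊆ cellBlock N y) :
    kModelMeasure k N d {ω | selectedIn ω m y = A} ≤
      ENNReal.ofReal (((N : ℝ) ^ d + 1) ^ 5 ^ d * (((k : ℝ) / (N : ℝ) ^ d) ^ A.card *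
        (1 - (k : ℝ) / (N : ℝ) ^ d) ^ (cellBlock N y \ A).card)) := by
  have := isProbabilityMeasure_uniformOn_card hk
  set r : ℝ := (k : ℝ) / (N : ℝ) ^ d with hr
  have hr0 : 0 ≤ r := by positivity
  have hr1 : r ≤ 1 := by
    rw [hr, div_le_one (by have := NeZero.pos N; positivity)]
    exact_mod_cast hk
  let X : (Fin d → ℤ) → Finset (SubcubeIndex N d) := fun c =>
    Finset.univ.filter fun i => joinCell c i ∈ A
  let s := (latticeBox y 2).image (addr N m)
  let t : List (SubcubeIndex N d) → Set (Finset (SubcubeIndex N d)) := fun I =>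
    {Z | ∀ c ∈ latticeBox y 2, addr N m c = I → Z = X c}
  have hsub : {ω : Configuration N d | selectedIn ω m y = A} ⊆ Set.pi s t := by
    rintro ω hω I - c hc rfl
    ext i
    have h1 : joinCell c i ∈ selectedIn ω m y ↔ joinCell c i ∈ A := by rw [show _ = _ from hω]
    simp only [selectedIn, Finset.mem_filter, mem_cellBlock, cellDiv_joinCell, digit_joinCell, hc,
      true_and] at h1
    simp [X, h1]
  have hcompl : ∀ c ∈ latticeBox y 2, (Finset.univ \ X c) =
      Finset.univ.filter fun i => joinCell c i ∈ cellBlock N y \ A := by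
    intro c hc
    ext i
    simp [X, mem_cellBlock, cellDiv_joinCell, hc]
  calc kModelMeasure k N d {ω | selectedIn ω m y = A}
      ≤ kModelMeasure k N d (Set.pi s t) := measure_mono hsub
    _ = ∏ I ∈ s, uniformOn {A : Finset (SubcubeIndex N d) | A.card = k} (t I) :=
        Measure.infinitePi_pi _ fun _ _ => (Set.toFinite _).measurableSet
    _ = ∏ c ∈ latticeBox y 2,
          uniformOn {A : Finset (SubcubeIndex N d) | A.card = k} (t (addr N m c)) :=
        Finset.prod_image (addr_injOn hm hN y)
    _ ≤ ∏ c ∈ latticeBox y 2, ENNReal.ofReal (((N : ℝ) ^ d + 1) * (r ^ (X c).card *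
          (1 - r) ^ (Finset.univ \ X c).card)) := by
        refine Finset.prod_le_prod' fun c hc => ?_
        refine le_trans (measure_mono ?_) (uniformOn_card_singleton_le hk (X c))
        exact fun Z hZ => hZ c hc rfl
    _ = ENNReal.ofReal (∏ c ∈ latticeBox y 2, (((N : ℝ) ^ d + 1) * (r ^ (X c).card *
          (1 - r) ^ (Finset.univ \ X c).card))) := by
        rw [ENNReal.ofReal_prod_of_nonneg]
        intro c _
        have : 0 ≤ 1 - r := by linarith
        positivity
    _ = _ := by
        rw [Finset.prod_mul_distrib, Finset.prod_mul_distrib, Finset.prod_const,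
          card_latticeBox_two, Finset.prod_pow_eq_pow_sum, Finset.prod_pow_eq_pow_sum,
          card_eq_sum_fiber hA, card_eq_sum_fiber (Finset.sdiff_subset (s := cellBlock N y)),
          Finset.sum_congr rfl fun c hc => congrArg Finset.card (hcompl c hc)]

/-- Probabilities of events near a cell in the `k`-model exceed those in Bernoulli percolation with
the same density by at most a polynomial factor. -/
theorem measure_selectedIn_le (hk : k ≤ N ^ d) (hN : 6 ≤ N) {m : ℕ} (hm : 1 ≤ m)
    (y : Fin d → ℤ) (P : Finset (Fin d → ℤ) → Prop) :
    kModelMeasure k N d {ω | P (selectedIn ω m y)} ≤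
      ENNReal.ofReal (((N : ℝ) ^ d + 1) ^ 5 ^ d *
        bernExp (cellBlock N y) ((k : ℝ) / (N : ℝ) ^ d) (ind P)) := by
  classical
  set r : ℝ := (k : ℝ) / (N : ℝ) ^ d with hr
  have hr0 : 0 ≤ r := by positivity
  have hr1 : 0 ≤ 1 - r := by
    rw [hr, sub_nonneg, div_le_one (by have := NeZero.pos N; positivity)]
    exact_mod_cast hk
  have hsub : {ω : Configuration N d | P (selectedIn ω m y)} ⊆
      ⋃ A ∈ (cellBlock N y).powerset.filter P, {ω | selectedIn ω m y = A} := by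
    intro ω hω
    refine Set.mem_biUnion (x := selectedIn ω m y) ?_ rfl
    simp only [Finset.coe_filter, Finset.mem_powerset]
    exact ⟨Finset.filter_subset _ _, hω⟩
  refine (measure_mono hsub).trans ((measure_biUnion_finset_le _ _).trans ?_)
  rw [bernExp, Finset.mul_sum, ENNReal.ofReal_sum_of_nonneg, Finset.sum_filter]
  · refine Finset.sum_le_sum fun A hA => ?_
    split_ifs with h
    · rw [ind_of h, mul_one]
      exact measure_selectedIn_eq_le hk hN hm y (Finset.mem_powerset.1 hA)
    · exact zero_le
  · intro A _
    have := ind_nonneg P A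
    positivity

theorem Reaches.exists_escapes {ω : Configuration N d} {m : ℕ} {y : Fin d → ℤ}
    (h : Reaches ω m 1 y) : ∃ x ∈ cellBlock N y, cellDiv N x = y ∧
      Escapes (latticeL d) (latticeBox x N) (selectedIn ω m y ∩ latticeBox x N) x := by
  classical
  obtain ⟨x₀, x₁, hx, h0, i, hi⟩ := h
  rw [pow_one] at hx h0 hi
  have hcl : x₁ ∈ cluster (latticeL d) (selectedIn ω m y) x₀ := by
    refine cluster_mono ?_ _ hx
    rintro x ⟨h1, h2⟩
    simp only [selectedIn, Finset.coe_filter, mem_cellBlock]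
    exact ⟨h2, h1.1⟩
  refine ⟨x₀, mem_cellBlock.2 (h0 ▸ self_mem_latticeBox _ _), h0, ?_⟩
  have hfar : x₁ ∉ latticeBox x₀ N := by
    intro hmem
    have := mem_latticeBox.1 hmem i
    rw [← h0] at hi
    have := le_abs_sub_of_two_le hi
    omega
  rcases cluster_inter_or_exit (V := (latticeBox x₀ N : Set (Fin d → ℤ)))
    (by exact_mod_cast self_mem_latticeBox _ _) hcl with h | ⟨w, hw, z, hz, hwz⟩
  · exact absurd (cluster_subset _ _ h).2 hfar
  · exact ⟨w, hw, z, hz.2, hwz⟩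

theorem latticeBox_subset_cellBlock {x y : Fin d → ℤ} (h : cellDiv N x = y) :
    latticeBox x N ⊆ cellBlock N y := by
  intro z hz
  have hN : (0 : ℤ) < N := intCast_pos_of_neZero
  rw [mem_cellBlock, mem_latticeBox]
  rw [mem_latticeBox] at hz
  intro i
  have h1 := hz i
  subst h
  simp only [cellDiv]
  rw [abs_le] at h1 ⊢
  have e1 : z i / (N : ℤ) ≤ (x i + 1 * N) / (N : ℤ) := Int.ediv_le_ediv hN (by linarith)
  have e2 : (x i + (-1) * N) / (N : ℤ) ≤ z i / (N : ℤ) := Int.ediv_le_ediv hN (by linarith)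
  rw [Int.add_mul_ediv_right _ _ hN.ne'] at e1 e2
  push_cast
  constructor <;> linarith

theorem measure_reaches_one_le (hk : k ≤ N ^ d) (hN : 6 ≤ N) {m : ℕ} (hm : 1 ≤ m)
    (y : Fin d → ℤ) {q : ℝ} (hq : (k : ℝ) / (N : ℝ) ^ d ≤ q) (hq1 : q ≤ 1) :
    kModelMeasure k N d {ω | Reaches ω m 1 y} ≤
      ENNReal.ofReal (((5 * N) ^ d : ℕ) * (((N : ℝ) ^ d + 1) ^ 5 ^ d *
        escapeProb (latticeL d) (latticeBox 0 N) q 0)) := by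
  have hr0 : (0 : ℝ) ≤ (k : ℝ) / (N : ℝ) ^ d := by positivity
  let K := (cellBlock N y).filter fun x => cellDiv N x = y
  have hsub : {ω : Configuration N d | Reaches ω m 1 y} ⊆ ⋃ x ∈ K, {ω |
      Escapes (latticeL d) (latticeBox x N) ((selectedIn ω m y ∩ latticeBox x N : Finset _) :
        Set (Fin d → ℤ)) x} := by
    intro ω hω
    obtain ⟨x, h1, h2, h3⟩ := Reaches.exists_escapes hω
    refine Set.mem_biUnion (x := x) ?_ ?_
    · simp only [K, Finset.coe_filter]
      exact ⟨h1, h2⟩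
    · rw [Set.mem_ofPred_eq, Finset.coe_inter]
      exact h3
  have hx : ∀ x ∈ K, kModelMeasure k N d {ω | Escapes (latticeL d) (latticeBox x N)
      ((selectedIn ω m y ∩ latticeBox x N : Finset _) : Set (Fin d → ℤ)) x} ≤
      ENNReal.ofReal (((N : ℝ) ^ d + 1) ^ 5 ^ d *
        escapeProb (latticeL d) (latticeBox 0 N) q 0) := by
    intro x hx
    refine (measure_selectedIn_le hk hN hm y fun A => Escapes (latticeL d) (latticeBox x N)
      ((A ∩ latticeBox x N : Finset _) : Set (Fin d → ℤ)) x).trans ?_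
    refine ENNReal.ofReal_le_ofReal (mul_le_mul_of_nonneg_left ?_ (by positivity))
    have hmono := bernExp_monotoneOn (latticeBox x N) (monotone_ind_escapes
      (G := latticeL d) (latticeBox x N) x) (Set.mem_Icc.2 ⟨hr0, hq.trans hq1⟩)
      (Set.mem_Icc.2 ⟨hr0.trans hq, hq1⟩) hq
    refine le_trans ?_ (hmono.trans (escapeProb_latticeBox_le (hr0.trans hq) hq1 x N))
    refine le_of_eq ?_
    exact bernExp_inter (latticeBox_subset_cellBlock (Finset.mem_filter.1 hx).2) _
      (ind fun A : Finset (Fin d → ℤ) => Escapes (latticeL d) (latticeBox x N) A x)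
  refine (measure_mono hsub).trans ((measure_biUnion_finset_le _ _).trans ?_)
  refine (Finset.sum_le_card_nsmul _ _ _ hx).trans ?_
  rw [nsmul_eq_mul, ENNReal.ofReal_mul (Nat.cast_nonneg _), ENNReal.ofReal_natCast]
  refine mul_le_mul_left ?_ _
  exact_mod_cast (Finset.card_filter_le _ _).trans (card_cellBlock_le y)

end Comparison

section Geometry

variable {N d k : ℕ}

theorem lowerCorner_append_singleton (I : List (SubcubeIndex N d)) (i : SubcubeIndex N d)
    (j : Fin d) :
    lowerCorner N d (I ++ [i]) j =
      lowerCorner N d I j + ((i j : ℕ) : ℝ) / (N : ℝ) ^ (I.length + 1) := by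
  have hlen : I.length + 1 = (I ++ [i]).length := by simp
  unfold lowerCorner
  rw [← (finCongr hlen).sum_comp, Fin.sum_univ_castSucc]
  simp

variable [NeZero N]

theorem exists_addr_eq (I : List (SubcubeIndex N d)) :
    ∃ z : Fin d → ℤ, (∀ j, 0 ≤ z j ∧ z j < (N : ℤ) ^ I.length) ∧ addr N I.length z = I := by
  induction I using List.reverseRecOn with
  | nil => exact ⟨0, by simp, rfl⟩
  | append_singleton I i ih =>
    obtain ⟨z, hz, hI⟩ := ih
    refine ⟨joinCell z i, fun j => ?_, ?_⟩
    · have h1 := hz j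
      have h2 : ((i j : ℕ) : ℤ) < N := by exact_mod_cast (i j).2
      have hN : (0 : ℤ) < N := intCast_pos_of_neZero
      simp only [joinCell, List.length_append, List.length_singleton, pow_succ']
      constructor
      · have := mul_nonneg hN.le h1.1
        positivity
      · nlinarith
    · simp only [List.length_append, List.length_singleton, addr, cellDiv_joinCell, digit_joinCell,
        hI]

theorem lowerCorner_addr {n : ℕ} {z : Fin d → ℤ} (hz : ∀ j, 0 ≤ z j ∧ z j < (N : ℤ) ^ n)
    (j : Fin d) : lowerCorner N d (addr N n z) j = (z j : ℝ) / (N : ℝ) ^ n := by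
  have hN : (0 : ℤ) < N := intCast_pos_of_neZero
  have hN' : (0 : ℝ) < N := by exact_mod_cast hN
  induction n generalizing z with
  | zero =>
    have := hz j
    have h0 : z j = 0 := by rw [pow_zero] at this; omega
    rw [h0, addr, lowerCorner, Int.cast_zero, zero_div]
    exact Finset.sum_eq_zero fun m _ => absurd m.2 (Nat.not_lt_zero _)
  | succ n ih =>
    rw [addr, lowerCorner_append_singleton, length_addr, ih]
    · have h1 := congrFun (joinCell_cellDiv_digit (N := N) z) j
      have h2 : (z j : ℝ) = N * (cellDiv N z j : ℝ) + (digit N z j : ℕ) := by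
        exact_mod_cast h1.symm
      rw [h2, pow_succ']
      field_simp
    · intro j
      refine ⟨Int.ediv_nonneg (hz j).1 hN.le, Int.ediv_lt_of_lt_mul hN ?_⟩
      rw [← pow_succ]; exact (hz j).2

theorem mem_levelCube_addr {n : ℕ} {z : Fin d → ℤ} (hz : ∀ j, 0 ≤ z j ∧ z j < (N : ℤ) ^ n)
    {x : Fin d → ℝ} : x ∈ levelCube N d (addr N n z) ↔
      ∀ j, (z j : ℝ) ≤ (N : ℝ) ^ n * x j ∧ (N : ℝ) ^ n * x j ≤ z j + 1 := by
  have hN : (0 : ℝ) < N := by exact_mod_cast NeZero.pos N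
  have hp : (0 : ℝ) < (N : ℝ) ^ n := by positivity
  unfold levelCube
  simp only [Set.mem_ofPred_eq, lowerCorner_addr hz, length_addr]
  refine forall_congr' fun j => and_congr ?_ ?_
  · rw [div_le_iff₀' hp]
  · rw [← add_div, le_div_iff₀' hp]

theorem mem_levelSet_iff {ω : Configuration N d} {n : ℕ} {x : Fin d → ℝ} :
    x ∈ levelSet ω n ↔ ∃ z : Fin d → ℤ, (∀ j, 0 ≤ z j ∧ z j < (N : ℤ) ^ n) ∧
      IsRetained ω (addr N n z) ∧
        ∀ j, (z j : ℝ) ≤ (N : ℝ) ^ n * x j ∧ (N : ℝ) ^ n * x j ≤ z j + 1 := by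
  simp only [levelSet, Set.mem_iUnion, Set.mem_ofPred_eq, exists_prop]
  constructor
  · rintro ⟨I, ⟨rfl, hI⟩, hx⟩
    obtain ⟨z, hz, hzI⟩ := exists_addr_eq I
    refine ⟨z, hz, hzI.symm ▸ hI, (mem_levelCube_addr hz).1 (hzI.symm ▸ hx)⟩
  · rintro ⟨z, hz, hr, hx⟩
    exact ⟨addr N n z, ⟨length_addr n z, hr⟩, (mem_levelCube_addr hz).2 hx⟩

/-- A crossing of the limit set yields, at every level, a path of retained cubes in `latticeL`,
unless the limit set contains a point of the grid of that level. -/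
theorem IsCrossedBy.exists_cluster [NeZero d] {ω : Configuration N d} {n : ℕ}
    (h : IsCrossedBy (limitSet ω))
    (hgrid : ∀ v : Fin d → ℤ, (fun j => (v j : ℝ) / (N : ℝ) ^ n) ∉ limitSet ω) :
    ∃ z₀ z₁ : Fin d → ℤ, (∀ j, 0 ≤ z₀ j ∧ z₀ j < (N : ℤ) ^ n) ∧ z₀ 0 = 0 ∧
      z₁ 0 = (N : ℤ) ^ n - 1 ∧ z₁ ∈ cluster (latticeL d) {z | RetainedFrom ω 0 n z} z₀ := by
  obtain ⟨x, hx, ⟨a, haC, -, ha0⟩, b, hbC, -, hb1⟩ := h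
  set C := connectedComponentIn (limitSet ω) x with hC
  have hCD : C ⊆ limitSet ω := connectedComponentIn_subset _ _
  let R : Set (Fin d → ℤ) := {z | (∀ j, 0 ≤ z j ∧ z j < (N : ℤ) ^ n) ∧ IsRetained ω (addr N n z)}
  let Q : (Fin d → ℤ) → Set (Fin d → ℝ) := fun z =>
    {x | ∀ j, (z j : ℝ) ≤ (N : ℝ) ^ n * x j ∧ (N : ℝ) ^ n * x j ≤ z j + 1}
  have hRfin : R.Finite := by
    refine (Finset.finite_toSet (Finset.Icc (fun _ : Fin d => (0 : ℤ))
      (fun _ => (N : ℤ) ^ n))).subset fun z hz => ?_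
    rw [Finset.mem_coe, Finset.mem_Icc]
    exact ⟨fun j => (hz.1 j).1, fun j => (hz.1 j).2.le⟩
  have hQ : ∀ z, IsClosed (Q z) := by
    intro z
    have : Q z = ⋂ j, ({x : Fin d → ℝ | (z j : ℝ) ≤ (N : ℝ) ^ n * x j} ∩
        {x | (N : ℝ) ^ n * x j ≤ z j + 1}) := by
      ext x; simp [Q]
    rw [this]
    refine isClosed_iInter fun j => IsClosed.inter ?_ ?_
    · exact isClosed_le (by fun_prop) (by fun_prop)
    · exact isClosed_le (by fun_prop) (by fun_prop)
  have hcover : ∀ y ∈ limitSet ω, ∃ z ∈ R, y ∈ Q z := by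
    intro y hy
    obtain ⟨z, h1, h2, h3⟩ := mem_levelSet_iff.1 (Set.mem_iInter.1 hy n)
    exact ⟨z, ⟨h1, h2⟩, h3⟩
  obtain ⟨z₀, hz₀, haz⟩ := hcover a (hCD haC)
  let K := cluster (latticeL d) R z₀
  have hK : K ⊆ R := cluster_subset _ _
  have hz₀K : z₀ ∈ K := mem_cluster_self hz₀
  have hmeet : ∀ y ∈ limitSet ω, ∀ z ∈ K, ∀ z' ∈ R \ K, y ∈ Q z → y ∉ Q z' := by
    intro y hy z hz z' hz' hyz hyz'
    have hne : z ≠ z' := fun h => hz'.2 (h ▸ hz)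
    have hle : ∀ j, |z j - z' j| ≤ 1 := by
      intro j
      have h1 := hyz j
      have h2 := hyz' j
      have h3 : (z j : ℝ) ≤ z' j + 1 := by linarith
      have h4 : (z' j : ℝ) ≤ z j + 1 := by linarith
      have h3' : z j ≤ z' j + 1 := by exact_mod_cast h3
      have h4' : z' j ≤ z j + 1 := by exact_mod_cast h4
      rw [abs_le]; constructor <;> linarith
    by_cases hex : ∃ j, z j = z' j
    · exact hz'.2 (cluster_step hz ⟨hne, hle, hex⟩ hz'.1)
    · push Not at hex
      refine hgrid (fun j => max (z j) (z' j)) ?_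
      convert hy using 1
      funext j
      have hp : (0 : ℝ) < (N : ℝ) ^ n := by
        have : (0 : ℝ) < N := by exact_mod_cast NeZero.pos N
        positivity
      rw [div_eq_iff hp.ne', mul_comm]
      have h1 := hyz j
      have h2 := hyz' j
      have h3 := abs_le.1 (hle j)
      rcases lt_or_gt_of_ne (hex j) with h | h
      · have e : z' j = z j + 1 := by omega
        have e' : (z' j : ℝ) = z j + 1 := by exact_mod_cast e
        rw [max_eq_right h.le]; linarith
      · have e : z j = z' j + 1 := by omega
        have e' : (z j : ℝ) = z' j + 1 := by exact_mod_cast e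
        rw [max_eq_left h.le]; linarith
  have hbU : b ∈ ⋃ z ∈ K, Q z := by
    by_contra hb
    have hbW : b ∈ ⋃ z ∈ R \ K, Q z := by
      obtain ⟨z, hz, hbz⟩ := hcover b (hCD hbC)
      refine Set.mem_biUnion ⟨hz, fun hzK => hb (Set.mem_biUnion hzK hbz)⟩ hbz
    obtain ⟨y, hyC, hyU, hyW⟩ := isPreconnected_closed_iff.1
      (isPreconnected_connectedComponentIn (F := limitSet ω) (x := x)) _ _
      ((hRfin.subset hK).isClosed_biUnion fun z _ => hQ z)
      ((hRfin.subset Set.sdiff_subset).isClosed_biUnion fun z _ => hQ z)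
      (fun y hy => by
        obtain ⟨z, hz, hyz⟩ := hcover y (hCD hy)
        by_cases hzK : z ∈ K
        · exact .inl (Set.mem_biUnion hzK hyz)
        · exact .inr (Set.mem_biUnion ⟨hz, hzK⟩ hyz))
      ⟨a, haC, Set.mem_biUnion hz₀K haz⟩ ⟨b, hbC, hbW⟩
    obtain ⟨z, hz, hyz⟩ := Set.mem_iUnion₂.1 hyU
    obtain ⟨z', hz', hyz'⟩ := Set.mem_iUnion₂.1 hyW
    exact hmeet y (hCD hyC) z hz z' hz' hyz hyz'
  obtain ⟨z₁, hz₁, hbz⟩ := Set.mem_iUnion₂.1 hbU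
  refine ⟨z₀, z₁, hz₀.1, ?_, ?_, cluster_mono (fun z hz => hz.2.retainedFrom) _ hz₁⟩
  · have h1 := (haz 0).1
    rw [ha0, mul_zero] at h1
    have h2 : z₀ 0 ≤ 0 := by exact_mod_cast h1
    exact le_antisymm h2 (hz₀.1 0).1
  · have h1 := (hbz 0).2
    rw [hb1, mul_one] at h1
    have h2 : (N : ℤ) ^ n ≤ z₁ 0 + 1 := by exact_mod_cast h1
    have h3 := ((hK hz₁).1 0).2
    omega

omit [NeZero N] in
theorem exists_uniformOn_mem_le (hk : k < N ^ d) :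
    ∃ ρ : ENNReal, ρ < 1 ∧ ∀ i : SubcubeIndex N d,
      uniformOn {A : Finset (SubcubeIndex N d) | A.card = k} {A | i ∈ A} ≤ ρ := by
  have := isProbabilityMeasure_uniformOn_card hk.le
  refine ⟨Finset.univ.sup fun i : SubcubeIndex N d =>
    uniformOn {A : Finset (SubcubeIndex N d) | A.card = k} {A | i ∈ A}, ?_,
    fun i => Finset.le_sup (f := fun i : SubcubeIndex N d =>
      uniformOn {A : Finset (SubcubeIndex N d) | A.card = k} {A | i ∈ A}) (Finset.mem_univ i)⟩
  rw [Finset.sup_lt_iff (by simp)]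
  intro i _
  refine lt_of_le_of_ne prob_le_one fun h => ?_
  have hsub := pred_true_of_uniformOn_eq_one h
  obtain ⟨A, hA, hAk⟩ := Finset.exists_subset_card_eq
    (s := (Finset.univ : Finset (SubcubeIndex N d)).erase i) (n := k) (by
      rw [Finset.card_erase_of_mem (Finset.mem_univ i), Finset.card_univ]
      simp
      omega)
  have hi : i ∈ A := hsub hAk
  simpa using hA hi

omit [NeZero N] in
theorem measure_isRetained_le (hk : k ≤ N ^ d) {ρ : ENNReal}
    (hρ : ∀ i : SubcubeIndex N d,
      uniformOn {A : Finset (SubcubeIndex N d) | A.card = k} {A | i ∈ A} ≤ ρ)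
    (I : List (SubcubeIndex N d)) :
    kModelMeasure k N d {ω | IsRetained ω I} ≤ ρ ^ I.length := by
  classical
  have := isProbabilityMeasure_uniformOn_card hk
  let s := (Finset.range I.length).image fun l => I.take l
  let t : List (SubcubeIndex N d) → Set (Finset (SubcubeIndex N d)) := fun J =>
    {Z | ∀ i, J ++ [i] <+: I → i ∈ Z}
  have hsub : {ω : Configuration N d | IsRetained ω I} ⊆ Set.pi s t :=
    fun ω hω J _ i hJ => hω J i hJ
  have hinj : Set.InjOn (fun l => I.take l) (Finset.range I.length : Set ℕ) := by
    intro l hl l' hl' h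
    have := congrArg List.length h
    simp only [Finset.coe_range, Set.mem_Iio] at hl hl'
    simp only [List.length_take] at this
    omega
  calc kModelMeasure k N d {ω | IsRetained ω I}
      ≤ kModelMeasure k N d (Set.pi s t) := measure_mono hsub
    _ = ∏ J ∈ s, uniformOn {A : Finset (SubcubeIndex N d) | A.card = k} (t J) :=
        Measure.infinitePi_pi _ fun _ _ => (Set.toFinite _).measurableSet
    _ = ∏ l ∈ Finset.range I.length,
          uniformOn {A : Finset (SubcubeIndex N d) | A.card = k} (t (I.take l)) :=
        Finset.prod_image hinj
    _ ≤ ∏ _l ∈ Finset.range I.length, ρ := by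
        refine Finset.prod_le_prod' fun l hl => ?_
        rw [Finset.mem_range] at hl
        refine le_trans (measure_mono fun Z hZ => ?_) (hρ I[l])
        refine hZ _ ?_
        rw [List.take_concat_get' I l hl]
        exact List.take_prefix _ _
    _ = ρ ^ I.length := by simp

/-- A fixed point almost surely does not belong to the limit set if `k < N ^ d`. -/
theorem measure_mem_limitSet_eq_zero (hk : k < N ^ d) (x : Fin d → ℝ) :
    kModelMeasure k N d {ω | x ∈ limitSet ω} = 0 := by
  obtain ⟨ρ, hρ1, hρ⟩ := exists_uniformOn_mem_le hk
  have hle : ∀ n : ℕ, kModelMeasure k N d {ω | x ∈ limitSet ω} ≤ ((5 ^ d : ℕ) : ENNReal) * ρ ^ n := by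
    intro n
    let y : Fin d → ℤ := fun j => ⌊(N : ℝ) ^ n * x j⌋
    have hsub : {ω : Configuration N d | x ∈ limitSet ω} ⊆
        ⋃ z ∈ latticeBox y 2, {ω | IsRetained ω (addr N n z)} := by
      intro ω hω
      obtain ⟨z, -, h2, h3⟩ := mem_levelSet_iff.1 (Set.mem_iInter.1 hω n)
      refine Set.mem_biUnion (x := z) (mem_latticeBox.2 fun j => ?_) h2
      have h4 : z j ≤ y j := Int.le_floor.2 (h3 j).1
      have h5 : (y j : ℝ) ≤ z j + 1 := (Int.floor_le _).trans (h3 j).2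
      have h5' : y j ≤ z j + 1 := by exact_mod_cast h5
      push_cast
      rw [abs_le]; constructor <;> linarith
    refine (measure_mono hsub).trans ((measure_biUnion_finset_le _ _).trans ?_)
    refine (Finset.sum_le_card_nsmul _ _ (ρ ^ n) fun z _ => ?_).trans ?_
    · exact (measure_isRetained_le hk.le hρ _).trans (by rw [length_addr])
    · rw [nsmul_eq_mul, card_latticeBox_two]
  have hlim : Tendsto (fun n : ℕ => ((5 ^ d : ℕ) : ENNReal) * ρ ^ n) atTop (nhds 0) := by
    have := ENNReal.Tendsto.const_mul (ENNReal.tendsto_pow_atTop_nhds_zero_of_lt_one hρ1)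
      (.inr (ENNReal.natCast_ne_top (5 ^ d)))
    rwa [mul_zero] at this
  exact le_antisymm (ge_of_tendsto' hlim hle) zero_le

theorem kCrossingProb_pow_pos (N d : ℕ) [NeZero N] [NeZero d] : 0 < kCrossingProb (N ^ d) N d := by
  have hprob := isProbabilityMeasure_uniformOn_card (le_refl (N ^ d))
  let ω₀ : Configuration N d := fun _ => Finset.univ
  have hN : (0 : ℝ) < N := by exact_mod_cast NeZero.pos N
  have hcube : Set.Icc (0 : Fin d → ℝ) 1 ⊆ limitSet ω₀ := by
    intro x hx
    refine Set.mem_iInter.2 fun n => mem_levelSet_iff.2 ?_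
    have hp : (0 : ℝ) < (N : ℝ) ^ n := by positivity
    have hp' : (0 : ℤ) < (N : ℤ) ^ n := by exact_mod_cast hp
    have hx0 : ∀ j, 0 ≤ (N : ℝ) ^ n * x j := fun j => mul_nonneg hp.le (hx.1 j)
    have hx1 : ∀ j, (N : ℝ) ^ n * x j ≤ (N : ℝ) ^ n := fun j => mul_le_of_le_one_right hp.le (hx.2 j)
    refine ⟨fun j => min ⌊(N : ℝ) ^ n * x j⌋ ((N : ℤ) ^ n - 1), fun j => ⟨?_, ?_⟩, ?_, fun j => ⟨?_, ?_⟩⟩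
    · exact le_min (Int.floor_nonneg.2 (hx0 j)) (by omega)
    · exact (min_le_right _ _).trans_lt (by omega)
    · exact fun J i _ => Finset.mem_univ i
    · exact le_trans (by exact_mod_cast min_le_left _ _) (Int.floor_le _)
    · beta_reduce
      rcases min_choice ⌊(N : ℝ) ^ n * x j⌋ ((N : ℤ) ^ n - 1) with h | h
      · rw [h]; exact (Int.lt_floor_add_one _).le
      · rw [h]; push_cast; linarith [hx1 j]
  have h0 : (0 : Fin d → ℝ) ∈ Set.Icc (0 : Fin d → ℝ) 1 := ⟨le_rfl, zero_le_one⟩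
  have h1 : (1 : Fin d → ℝ) ∈ Set.Icc (0 : Fin d → ℝ) 1 := ⟨zero_le_one, le_rfl⟩
  have hcross : IsCrossedBy (limitSet ω₀) := by
    have hcomp := (convex_Icc (0 : Fin d → ℝ) 1).isPreconnected.subset_connectedComponentIn
      h0 hcube
    exact ⟨0, hcube h0, ⟨0, hcomp h0, h0, rfl⟩, ⟨1, hcomp h1, h1, rfl⟩⟩
  have hone : uniformOn {A : Finset (SubcubeIndex N d) | A.card = N ^ d} {Finset.univ} = 1 := by
    refine uniformOn_eq_one_of (Set.toFinite _) ⟨Finset.univ, by simp⟩ fun A hA => ?_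
    have : A.card = Fintype.card (SubcubeIndex N d) := by
      rw [show A.card = N ^ d from hA]; simp
    exact (Finset.card_eq_iff_eq_univ A).1 this
  have hmeas : kModelMeasure (N ^ d) N d {ω₀} = 1 := by
    unfold kModelMeasure
    rw [Measure.infinitePi_singleton]
    simp [ω₀, hone]
  refine lt_of_lt_of_le ?_ (measure_mono (Set.singleton_subset_iff.2 hcross))
  rw [hmeas]
  exact zero_lt_one

end Geometry

section CriticalValue

variable {N d k : ℕ}

theorem IsCrossedBy.exists_reaches [NeZero N] [NeZero d] (hN : 3 ≤ N) {ω : Configuration N d}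
    {n : ℕ} (h : IsCrossedBy (limitSet ω))
    (hgrid : ∀ v : Fin d → ℤ, (fun j => (v j : ℝ) / (N : ℝ) ^ (n + 1)) ∉ limitSet ω) :
    ∃ Q ∈ Finset.Icc (0 : Fin d → ℤ) (fun _ => (N : ℤ)), Reaches ω 1 n Q := by
  obtain ⟨z₀, z₁, hz, h0, h1, hcl⟩ := h.exists_cluster hgrid
  have hN0 : (0 : ℤ) < N := intCast_pos_of_neZero
  have hp : (0 : ℤ) < (N : ℤ) ^ n := by positivity
  have hcl' : z₁ ∈ cluster (latticeL d) {x | RetainedFrom ω 1 n x} z₀ := by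
    refine cluster_mono (fun z hz => ?_) _ hcl
    have := RetainedFrom.succ_left (m := 0) hz
    rwa [zero_add] at this
  refine ⟨cellDiv (N ^ n) z₀, Finset.mem_Icc.2 ⟨fun j => ?_, fun j => ?_⟩,
    reaches_of_mem_cluster hcl' ⟨0, ?_⟩⟩
  · exact Int.ediv_nonneg (hz j).1 (by positivity)
  · refine (Int.ediv_lt_of_lt_mul (by exact_mod_cast hp) ?_).le
    push_cast
    rw [← pow_succ']
    exact (hz j).2
  · have h2 : 2 ≤ ((N : ℤ) ^ (n + 1) - 1) / ((N ^ n : ℕ) : ℤ) := by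
      rw [Int.le_ediv_iff_mul_le (by exact_mod_cast hp)]
      push_cast
      have h3 : (3 : ℤ) ≤ N := by exact_mod_cast hN
      rw [pow_succ']
      nlinarith
    simp only [cellDiv, h0, h1]
    rw [Int.zero_ediv, sub_zero]
    exact h2.trans (le_abs_self _)

/-- The crossing probability vanishes if crossings of a cell are unlikely enough at the first
level. -/
theorem kCrossingProb_eq_zero [NeZero N] [NeZero d] (hk : k < N ^ d) (hN : 6 ≤ N)
    (h : ∀ m ≥ 1, ∀ y : Fin d → ℤ, kModelMeasure k N d {ω | Reaches ω m 1 y} ≤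
      ((((5 * N) ^ d : ℕ) : ENNReal) ^ 2)⁻¹ * 2⁻¹) :
    kCrossingProb k N d = 0 := by
  set C : ENNReal := (((5 * N) ^ d : ℕ) : ENNReal) ^ 2 with hC
  have hC0 : C ≠ 0 := pow_ne_zero _ (Nat.cast_ne_zero.2 (pow_ne_zero _ (by omega)))
  let K := Finset.Icc (0 : Fin d → ℤ) (fun _ => (N : ℤ))
  let Z : Set (Configuration N d) :=
    ⋃ n : ℕ, ⋃ v : Fin d → ℤ, {ω | (fun j => (v j : ℝ) / (N : ℝ) ^ n) ∈ limitSet ω}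
  have hZ : kModelMeasure k N d Z = 0 :=
    measure_iUnion_null fun n => measure_iUnion_null fun v => measure_mem_limitSet_eq_zero hk _
  have hle : ∀ n : ℕ, kCrossingProb k N d ≤ K.card * C⁻¹ * 2⁻¹ ^ (n + 1) := by
    intro n
    have hsub : {ω : Configuration N d | IsCrossedBy (limitSet ω)} ⊆
        (⋃ Q ∈ K, {ω | Reaches ω 1 (n + 1) Q}) ∪ Z := by
      intro ω hω
      by_cases hωZ : ω ∈ Z
      · exact .inr hωZ
      · refine .inl ?_
        obtain ⟨Q, hQ, hR⟩ := IsCrossedBy.exists_reaches (n := n + 1) (by omega) hω fun v hv =>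
          hωZ (Set.mem_iUnion₂.2 ⟨_, v, hv⟩)
        exact Set.mem_biUnion (x := Q) hQ hR
    calc kCrossingProb k N d ≤ kModelMeasure k N d ((⋃ Q ∈ K, {ω | Reaches ω 1 (n + 1) Q}) ∪ Z) :=
          measure_mono hsub
      _ ≤ kModelMeasure k N d (⋃ Q ∈ K, {ω | Reaches ω 1 (n + 1) Q}) + kModelMeasure k N d Z :=
          measure_union_le _ _
      _ ≤ ∑ Q ∈ K, kModelMeasure k N d {ω | Reaches ω 1 (n + 1) Q} := by
          rw [hZ, add_zero]; exact measure_biUnion_finset_le _ _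
      _ ≤ K.card • (C⁻¹ * 2⁻¹ ^ (n + 1)) :=
          Finset.sum_le_card_nsmul _ _ _ fun Q _ => measure_reaches_le hk.le hN h n 1 le_rfl Q
      _ = _ := by rw [nsmul_eq_mul, mul_assoc]
  have hlim : Tendsto (fun n : ℕ => K.card * C⁻¹ * (2⁻¹ : ENNReal) ^ (n + 1)) atTop (nhds 0) := by
    have h1 := (tendsto_add_atTop_iff_nat 1).2
      (ENNReal.tendsto_pow_atTop_nhds_zero_of_lt_one (r := 2⁻¹)
        (ENNReal.inv_lt_one.2 ENNReal.one_lt_two))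
    have := ENNReal.Tendsto.const_mul (a := K.card * C⁻¹) h1
      (.inr (ENNReal.mul_ne_top (ENNReal.natCast_ne_top _) (ENNReal.inv_ne_top.2 hC0)))
    rwa [mul_zero] at this
  exact le_antisymm (ge_of_tendsto' hlim hle) zero_le

theorem kCritical_mem (N d : ℕ) [NeZero N] [NeZero d] :
    0 < kCritical N d ∧ kCritical N d ≤ N ^ d ∧ 0 < kCrossingProb (kCritical N d) N d :=
  Nat.sInf_mem (s := {k : ℕ | 0 < k ∧ k ≤ N ^ d ∧ 0 < kCrossingProb k N d})
    ⟨N ^ d, pow_pos (NeZero.pos N) d, le_rfl, kCrossingProb_pow_pos N d⟩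

theorem tendsto_pow_mul_pow_div {φ : ℝ} (h0 : 0 ≤ φ) (h1 : φ < 1) (L D : ℕ) :
    Tendsto (fun n : ℕ => (n : ℝ) ^ D * φ ^ (n / (L + 1))) atTop (nhds 0) := by
  have h2 := (tendsto_pow_const_mul_const_pow_of_lt_one D h0 h1).comp
    (Nat.tendsto_div_const_atTop (Nat.succ_ne_zero L))
  have h3 := h2.const_mul ((2 * (L + 1 : ℝ)) ^ D)
  rw [mul_zero] at h3
  refine squeeze_zero' (.of_forall fun n => by positivity) ?_ h3
  filter_upwards [eventually_ge_atTop (L + 1)] with n hn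
  simp only [Function.comp_apply, Nat.succ_eq_add_one]
  rw [← mul_assoc, ← mul_pow]
  refine mul_le_mul_of_nonneg_right (pow_le_pow_left₀ (Nat.cast_nonneg _) ?_ _) (by positivity)
  have h4 : 1 ≤ n / (L + 1) := (Nat.one_le_div_iff (Nat.succ_pos L)).2 hn
  have h5 := Nat.lt_div_mul_add (a := n) (Nat.succ_pos L)
  have h6 : n ≤ 2 * (L + 1) * (n / (L + 1)) := by
    rw [Nat.succ_eq_add_one] at h5
    nlinarith
  exact_mod_cast h6

theorem eventually_mul_escapeProb_le (d : ℕ) {q φ : ℝ} (h0 : 0 ≤ φ) (h1 : φ < 1) {L : ℕ}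
    (h : ∀ n, escapeProb (latticeL d) (latticeBox 0 n) q 0 ≤ φ ^ (n / (L + 1))) :
    ∀ᶠ N : ℕ in atTop, ((5 * N) ^ d : ℕ) * (((N : ℝ) ^ d + 1) ^ 5 ^ d *
      escapeProb (latticeL d) (latticeBox 0 N) q 0) ≤ ((((5 * N) ^ d : ℕ) : ℝ) ^ 2)⁻¹ * 2⁻¹ := by
  set D : ℕ := 3 * d + d * 5 ^ d with hD
  have hlim := (tendsto_pow_mul_pow_div h0 h1 L D).const_mul ((5 : ℝ) ^ (3 * d) * 2 ^ 5 ^ d)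
  rw [mul_zero] at hlim
  filter_upwards [hlim.eventually_le_const (u := 2⁻¹) (by norm_num), eventually_ge_atTop 1]
    with N hlimN hN
  have hN1 : (1 : ℝ) ≤ N := by exact_mod_cast hN
  have hpow : (1 : ℝ) ≤ (N : ℝ) ^ d := one_le_pow₀ hN1
  have hC : (0 : ℝ) < (((5 * N) ^ d : ℕ) : ℝ) ^ 2 := by positivity
  rw [← div_eq_inv_mul, le_div_iff₀ hC]
  refine le_trans ?_ hlimN
  calc (((5 * N) ^ d : ℕ) : ℝ) * (((N : ℝ) ^ d + 1) ^ 5 ^ d *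
        escapeProb (latticeL d) (latticeBox 0 N) q 0) * (((5 * N) ^ d : ℕ) : ℝ) ^ 2
      ≤ (((5 * N) ^ d : ℕ) : ℝ) * ((2 * (N : ℝ) ^ d) ^ 5 ^ d * φ ^ (N / (L + 1))) *
          (((5 * N) ^ d : ℕ) : ℝ) ^ 2 := by
        refine mul_le_mul_of_nonneg_right (mul_le_mul_of_nonneg_left ?_ (by positivity)) hC.le
        refine (mul_le_mul_of_nonneg_left (h N) (by positivity)).trans ?_
        exact mul_le_mul_of_nonneg_right
          (pow_le_pow_left₀ (by positivity) (by linarith) _) (pow_nonneg h0 _)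
    _ = _ := by
        rw [hD]
        push_cast
        ring

/-- Below the critical density for site percolation, the limit set of the `k`-model is almost surely
not crossing if `N` is large. -/
theorem eventually_kCrossingProb_eq_zero [NeZero d] {p : ℝ} (h0 : 0 ≤ p)
    (hp : p < siteCritical d) :
    ∀ᶠ N : ℕ in atTop, ∀ k : ℕ, (k : ℝ) / (N : ℝ) ^ d ≤ p → kCrossingProb k N d = 0 := by
  obtain ⟨q, hpq, hq1, φ, hφ0, hφ1, L, hL⟩ := exists_exponential_decay h0 hp
  filter_upwards [eventually_mul_escapeProb_le d hφ0 hφ1 hL, eventually_ge_atTop 6]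
    with N hbound hN k hk
  have : NeZero N := ⟨by omega⟩
  have hNpos : (0 : ℝ) < (N : ℝ) ^ d := by
    have : (0 : ℝ) < N := by exact_mod_cast NeZero.pos N
    positivity
  have hkN : k < N ^ d := by
    have h1 : (k : ℝ) / (N : ℝ) ^ d < 1 := (hk.trans_lt hpq).trans hq1
    rw [div_lt_one hNpos] at h1
    exact_mod_cast h1
  refine kCrossingProb_eq_zero hkN hN fun m hm y => ?_
  refine (measure_reaches_one_le hkN.le hN hm y (hk.trans hpq.le) hq1.le).trans ?_
  refine (ENNReal.ofReal_le_ofReal hbound).trans (le_of_eq ?_)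
  have hpos : (0 : ℝ) < (((5 * N) ^ d : ℕ) : ℝ) ^ 2 := by
    have := NeZero.pos N
    positivity
  rw [ENNReal.ofReal_mul (by positivity), ENNReal.ofReal_inv_of_pos hpos,
    ENNReal.ofReal_inv_of_pos two_pos, ENNReal.ofReal_pow (by positivity), ENNReal.ofReal_natCast,
    ENNReal.ofReal_ofNat]

end CriticalValue

theorem theorem5 (d : ℕ) [NeZero d] (hd : 2 ≤ d) :
    siteCritical d ≤
      Filter.liminf (fun N : ℕ => (kCritical N d : ℝ) / (N : ℝ) ^ d) Filter.atTop := by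
  have hle : ∀ᶠ N : ℕ in atTop, (kCritical N d : ℝ) / (N : ℝ) ^ d ≤ 1 := by
    filter_upwards [eventually_ge_atTop 1] with N hN
    have : NeZero N := ⟨by omega⟩
    refine div_le_one_of_le₀ ?_ (by positivity)
    exact_mod_cast (kCritical_mem N d).2.1
  have hcob : IsCoboundedUnder (· ≥ ·) atTop
      fun N : ℕ => (kCritical N d : ℝ) / (N : ℝ) ^ d :=
    (isBoundedUnder_of_eventually_le hle).isCoboundedUnder_ge
  refine le_of_forall_lt_imp_le_of_dense fun p hp => le_liminf_of_le hcob ?_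
  rcases lt_or_ge p 0 with hp0 | hp0
  · exact .of_forall fun N => hp0.le.trans (by positivity)
  · filter_upwards [eventually_kCrossingProb_eq_zero hp0 hp, eventually_ge_atTop 1] with N hN hN1
    have : NeZero N := ⟨by omega⟩
    by_contra! hlt
    exact (kCritical_mem N d).2.2.ne' (hN _ hlt.le)
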